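/- Let $P$ be the partially ordered set of nonempty finite subsets of $\{1,2,3,\dots\}$ (ordered by inclusion) and, for $n\ge 1$, let $P^n\subset P$ consist of the nonempty subsets of $\{1,\dots,n\}$. Let $\Delta$ be the category of the ordered sets $[q]=\{0<\dots<q\}$, $q\ge 0$, and order-preserving maps, and let $\Delta^{<n}\subset\Delta$ be the full subcategory on the objects $[q]$ with $q<n$. Let $f\colon P\to\Delta$ be the functor that sends $T=\{t_0<\dots<t_q\}$ to $[q]$ and sends the inclusion $T\setminus\{t_i\}\subset T$ to the coface map $\delta^i\colon[q-1]\to[q]$ (so an inclusion $T\subseteq T'$ goes to the order-preserving injection that it induces on indices), and let $f^n\colon P^n\to\Delta^{<n}$ be its restriction. A functor $F\colon D\to C$ of small categories is called left cofinal if for each object $c$ of $C$ the left fiber $F/c$, with objects the pairs $(d,\,F(d)\to c)$, has contractible nerve. Then the following hold. 1. The functors $f\colon P\to\Delta$ and $f^n\colon P^n\to\Delta^{<n}$, for all $n\ge 1$, are left cofinal. 2. For every cosimplicial spectrum $Y^\bullet\colon\Delta\to\mathrm{Sp}$ the canonical map $$f^*\colon \operatorname{holim}_{\Delta} Y^\bullet\longrightarrow\operatorname{holim}_{P}\,(Y^\bullet\circ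 f)$$ is a stable equivalence of spectra. 3. For every $n\ge 1$ and every $(n-1)$-truncated cosimplicial spectrum $Y^\bullet_{<n}\colon\Delta^{<n}\to\mathrm{Sp}$ the canonical map $$f_n^*\colon \operatorname{holim}_{\Delta^{<n}} Y_{<n}^\bullet\longrightarrow\operatorname{holim}_{P^n}\,(Y_{<n}^\bullet\circ f^n)$$ is a stable equivalence of spectra. Here $\mathrm{Sp}$ is the category of Bousfield--Friedlander spectra of simplicial sets; $\operatorname{holim}$ is the Bousfield--Kan homotopy limit, formed levelwise, of the diagram obtained by first replacing each vertex, naturally in the diagram, by a fibrant spectrum (an $\Omega$-spectrum whose levels are Kan complexes) through stable equivalences; 2 and 3 hold for every choice of such a replacement. A stable equivalence is a map that induces isomorphisms on all stable homotopy groups. -/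

import Mathlib

open CategoryTheory Simplicial MonoidalCategory Opposite

namespace CosimplicialDescent

noncomputable section

/-! ### Weak equivalences of simplicial sets and pointed simplicial sets -/

/-- A map `f : A ⟶ B` of simplicial sets is a weak homotopy equivalence if for every Kan complex
`K` composition with `f` is a bijection `[B, K] → [A, K]` on simplicial homotopy classes. -/
def WeakEquiv {A B : SSet.{0}} (f : A ⟶ B) : Prop :=
  ∀ (K : SSet.{0}) [SSet.KanComplex K],
    (∀ g : A ⟶ K, ∃ h : B ⟶ K, Nonempty (SSet.Homotopy (f ≫ h) g)) ∧
    (∀ h h' : B ⟶ K, Nonempty (SSet.Homotopy (f ≫ h) (f ≫ h')) → Nonempty (SSet.Homotopy h h'))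

/-- A simplicial set is (weakly) contractible if the map to the point `Δ[0]` is a weak
homotopy equivalence. -/
def IsContractible (A : SSet.{0}) : Prop :=
  WeakEquiv (SSet.stdSimplex.isTerminalObj₀.from A)

lemma map_comp_yonedaEquiv_symm {K : SSet.{0}} {n m : SimplexCategoryᵒᵖ} (θ : n ⟶ m)
    (a : K.obj n) :
    SSet.stdSimplex.map θ.unop ≫ (SSet.yonedaEquiv.symm a : SSet.stdSimplex.obj n.unop ⟶ K) =
      SSet.yonedaEquiv.symm (K.map θ a) := by
  apply SSet.yonedaEquiv.injective
  rw [Equiv.apply_symm_apply]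
  change K.map (𝟙 _ ≫ θ.unop).op a = _
  rw [Category.id_comp]
  rfl

lemma stdSimplex_map_id (n : SimplexCategory) :
    SSet.stdSimplex.{0}.map (𝟙 n) = 𝟙 (SSet.stdSimplex.{0}.obj n) :=
  CategoryTheory.Functor.map_id (C := SimplexCategory) (D := SSet.{0}) SSet.stdSimplex n

lemma stdSimplex_map_comp {n m l : SimplexCategory} (f : n ⟶ m) (g : m ⟶ l) :
    SSet.stdSimplex.{0}.map (f ≫ g) = SSet.stdSimplex.map f ≫ SSet.stdSimplex.map g :=
  CategoryTheory.Functor.map_comp (C := SimplexCategory) (D := SSet.{0}) SSet.stdSimplex f g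

/-- Pointed simplicial sets. -/
structure PSSet where
  /-- the underlying simplicial set -/
  X : SSet.{0}
  /-- the base point -/
  pt : X _⦋0⦌

namespace PSSet

/-- Pointed maps. -/
@[ext]
structure Hom (A B : PSSet) where
  /-- the underlying map of simplicial sets -/
  map : A.X ⟶ B.X
  map_pt : map.app _ A.pt = B.pt

instance : Category PSSet where
  Hom := Hom
  id A := ⟨𝟙 _, rfl⟩
  comp f g := ⟨f.map ≫ g.map, by
    change g.map.app _ (f.map.app _ _) = _
    rw [f.map_pt, g.map_pt]⟩

@[ext]
lemma hom_ext {A B : PSSet} {f g : A ⟶ B} (h : f.map = g.map) : f = g := Hom.ext h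

@[simp] lemma id_map (A : PSSet) : Hom.map (𝟙 A) = 𝟙 A.X := rfl

@[simp] lemma comp_map {A B C : PSSet} (f : A ⟶ B) (g : B ⟶ C) :
    (f ≫ g).map = f.map ≫ g.map := rfl

lemma const_comp {A : SSet.{0}} {B C : PSSet} (f : B ⟶ C) :
    (SSet.const B.pt : A ⟶ B.X) ≫ f.map = SSet.const C.pt := by
  rw [SSet.const_comp, f.map_pt]

/-- The functor forgetting base points. -/
@[simps]
def forget : PSSet ⥤ SSet.{0} where
  obj A := A.X
  map f := f.map

/-- The underlying simplicial set of the loop object `Ω B`: an `n`-simplex is a map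
`Δ[n] × Δ[1] ⟶ B` that sends `Δ[n] × ∂Δ[1]` to the base point, that is, a pointed map
`Δ[n]₊ ∧ S¹ ⟶ B` with `S¹ = Δ[1]/∂Δ[1]`. -/
def loopSSet (B : PSSet) : SSet.{0} where
  obj n := { φ : SSet.stdSimplex.obj n.unop ⊗ Δ[1] ⟶ B.X //
    SSet.ι₀ ≫ φ = SSet.const B.pt ∧ SSet.ι₁ ≫ φ = SSet.const B.pt }
  map θ := ↾fun φ ↦ ⟨(SSet.stdSimplex.map θ.unop ▷ Δ[1]) ≫ φ.1, by
    rw [SSet.ι₀_comp_assoc, SSet.ι₁_comp_assoc, φ.2.1, φ.2.2]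
    exact ⟨rfl, rfl⟩⟩
  map_id n := by
    refine ConcreteCategory.hom_ext _ _ fun φ ↦ Subtype.ext ?_
    change (SSet.stdSimplex.map (𝟙 n.unop) ▷ Δ[1]) ≫ φ.1 = φ.1
    rw [stdSimplex_map_id, id_whiskerRight, Category.id_comp]
  map_comp θ θ' := by
    refine ConcreteCategory.hom_ext _ _ fun φ ↦ Subtype.ext ?_
    change (SSet.stdSimplex.map (θ'.unop ≫ θ.unop) ▷ Δ[1]) ≫ φ.1 =
      (SSet.stdSimplex.map θ'.unop ▷ Δ[1]) ≫ (SSet.stdSimplex.map θ.unop ▷ Δ[1]) ≫ φ.1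
    rw [stdSimplex_map_comp, comp_whiskerRight, Category.assoc]

/-- The loop object `Ω B`, pointed by the constant loop. -/
def loopObj (B : PSSet) : PSSet where
  X := B.loopSSet
  pt := ⟨SSet.const B.pt, rfl, rfl⟩

/-- The loop functor `Ω` on pointed simplicial sets. -/
def loop : PSSet ⥤ PSSet where
  obj := loopObj
  map {A B} f :=
    { map :=
        { app n := ↾fun φ ↦ ⟨φ.1 ≫ f.map, by
            rw [← Category.assoc, ← Category.assoc, φ.2.1, φ.2.2, const_comp]
            exact ⟨rfl, rfl⟩⟩
          naturality n m θ := by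
            ext φ
            apply Subtype.ext
            exact Category.assoc _ _ _ }
      map_pt := Subtype.ext (const_comp f) }
  map_id A := by
    apply PSSet.hom_ext
    ext n φ
    apply Subtype.ext
    exact Category.comp_id _
  map_comp f g := by
    apply PSSet.hom_ext
    ext n φ
    apply Subtype.ext
    exact (Category.assoc _ _ _).symm

/-- The iterated loop functor `Ωᵐ`, with `Ωᵐ⁺¹ B = Ωᵐ (Ω B)`. -/
def loopIter (m : ℕ) : PSSet ⥤ PSSet :=
  Nat.rec (motive := fun _ ↦ PSSet ⥤ PSSet) (𝟭 PSSet) (fun _ G ↦ loop ⋙ G) m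

/-- A pointed map `A ∧ S¹ ⟶ B` with `S¹ = Δ[1]/∂Δ[1]`, given as a map `A × Δ[1] ⟶ B` that sends
`A × ∂Δ[1]` and `pt × Δ[1]` to the base point. -/
@[ext]
structure SuspMap (A B : PSSet) where
  /-- the map `A × Δ[1] ⟶ B` -/
  map : A.X ⊗ Δ[1] ⟶ B.X
  map_zero : SSet.ι₀ ≫ map = SSet.const B.pt
  map_one : SSet.ι₁ ≫ map = SSet.const B.pt
  map_pt : CartesianMonoidalCategory.lift (SSet.const A.pt) (𝟙 Δ[1]) ≫ map = SSet.const B.pt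

/-- The adjoint `A ⟶ Ω B` of a pointed map `A ∧ S¹ ⟶ B`. -/
def SuspMap.adj {A B : PSSet} (σ : SuspMap A B) : A ⟶ loop.obj B where
  map :=
    { app n := ↾fun a ↦ ⟨(SSet.yonedaEquiv.symm a ▷ Δ[1]) ≫ σ.map, by
        rw [SSet.ι₀_comp_assoc, SSet.ι₁_comp_assoc, σ.map_zero, σ.map_one]
        exact ⟨rfl, rfl⟩⟩
      naturality n m θ := by
        ext a
        apply Subtype.ext
        change (SSet.yonedaEquiv.symm (A.X.map θ a) ▷ Δ[1]) ≫ σ.map =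
          (SSet.stdSimplex.map θ.unop ▷ Δ[1]) ≫ (SSet.yonedaEquiv.symm a ▷ Δ[1]) ≫ σ.map
        rw [← Category.assoc, ← comp_whiskerRight, map_comp_yonedaEquiv_symm] }
  map_pt := by
    apply Subtype.ext
    change (SSet.yonedaEquiv.symm A.pt ▷ Δ[1]) ≫ σ.map = SSet.const B.pt
    rw [SSet.yonedaEquiv_symm_zero]
    change CartesianMonoidalCategory.snd _ _ ≫
      CartesianMonoidalCategory.lift (SSet.const A.pt) (𝟙 Δ[1]) ≫ σ.map = _
    rw [σ.map_pt]
    rfl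

end PSSet

/-! ### Spectra -/

/-- A (Bousfield--Friedlander) spectrum: a sequence of pointed simplicial sets `X₀, X₁, …` with
pointed structure maps `Xₖ ∧ S¹ ⟶ Xₖ₊₁`. -/
structure Spectrum where
  /-- the levels -/
  level : ℕ → PSSet
  /-- the structure maps -/
  str (k : ℕ) : PSSet.SuspMap (level k) (level (k + 1))

namespace Spectrum

/-- Maps of spectra: levelwise pointed maps strictly compatible with the structure maps. -/
@[ext]
structure Hom (X Y : Spectrum) where
  /-- the levels -/
  f (k : ℕ) : X.level k ⟶ Y.level k
  comm (k : ℕ) : (X.str k).map ≫ (f (k + 1)).map = ((f k).map ▷ Δ[1]) ≫ (Y.str k).map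

instance : Category Spectrum where
  Hom := Hom
  id X := ⟨fun k ↦ 𝟙 _, fun k ↦ by simp⟩
  comp f g := ⟨fun k ↦ f.f k ≫ g.f k, fun k ↦ by
    simp only [PSSet.comp_map, comp_whiskerRight, Category.assoc, ← g.comm k]
    rw [← Category.assoc, f.comm k, Category.assoc]⟩

@[ext]
lemma hom_ext {X Y : Spectrum} {f g : X ⟶ Y} (h : ∀ k, f.f k = g.f k) : f = g :=
  Hom.ext (funext h)

/-- The `k`-th level of a spectrum, as a functor. -/
@[simps]
def levelFunctor (k : ℕ) : Spectrum ⥤ PSSet where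
  obj X := X.level k
  map f := f.f k

lemma adj_naturality {X Y : Spectrum} (f : X ⟶ Y) (k : ℕ) :
    (X.str k).adj ≫ PSSet.loop.map (f.f (k + 1)) = f.f k ≫ (Y.str k).adj := by
  apply PSSet.hom_ext
  ext n a
  apply Subtype.ext
  change (SSet.yonedaEquiv.symm a ▷ Δ[1] ≫ (X.str k).map) ≫ (f.f (k + 1)).map =
    SSet.yonedaEquiv.symm ((f.f k).map.app _ a) ▷ Δ[1] ≫ (Y.str k).map
  rw [Category.assoc, f.comm, ← SSet.yonedaEquiv_symm_comp, comp_whiskerRight, Category.assoc]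

/-- All levels are Kan complexes. -/
def IsLevelKan (X : Spectrum) : Prop := ∀ k, SSet.KanComplex (X.level k).X

/-- Levelwise weak homotopy equivalences. -/
def IsLevelEquiv {X Y : Spectrum} (f : X ⟶ Y) : Prop := ∀ k, WeakEquiv (f.f k).map

/-- Fibrant spectra (in the stable model structure): `Ω`-spectra all of whose levels are
Kan complexes. -/
def IsFibrant (X : Spectrum) : Prop :=
  X.IsLevelKan ∧ ∀ k, WeakEquiv (X.str k).adj.map

/-- The sequence `n ↦ π₀ Ωʲ⁺ⁿ Xᵢ₊ₙ`. -/
def piSeq (i j : ℕ) (X : Spectrum) : ℕ ⥤ Type :=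
  Functor.ofSequence (X := fun n ↦ SSet.π₀ ((PSSet.loopIter (j + n)).obj (X.level (i + n))).X)
    (fun n ↦ SSet.π₀Functor.map ((PSSet.loopIter (j + n)).map (X.str (i + n)).adj).map)

/-- The map of sequences `π₀ Ωʲ⁺ⁿ Xᵢ₊ₙ ⟶ π₀ Ωʲ⁺ⁿ Yᵢ₊ₙ` induced by a map of spectra. -/
def piSeqMap (i j : ℕ) {X Y : Spectrum} (f : X ⟶ Y) : piSeq i j X ⟶ piSeq i j Y :=
  NatTrans.ofSequence
    (fun n ↦ SSet.π₀Functor.map ((PSSet.loopIter (j + n)).map (f.f (i + n))).map)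
    (fun n ↦ by
      have h := congrArg (fun g ↦ SSet.π₀Functor.map ((PSSet.loopIter (j + n)).map g).map)
        (adj_naturality f (i + n))
      simp only [Functor.map_comp, PSSet.comp_map] at h
      refine Eq.trans (congrArg (· ≫ _) (Functor.ofSequence_map_homOfLE_succ _ n)) ?_
      refine Eq.trans ?_ (congrArg (_ ≫ ·) (Functor.ofSequence_map_homOfLE_succ _ n)).symm
      exact h)

/-- For a spectrum `X` whose levels are Kan complexes, the stable homotopy group
`π_{j-i} X = colimₙ π_{j+n} Xᵢ₊ₙ = colimₙ π₀ Ωʲ⁺ⁿ Xᵢ₊ₙ` (as a set). -/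
def stablePi (i j : ℕ) (X : Spectrum) : Type := Limits.colimit (piSeq i j X)

/-- The map induced by a map of spectra on the stable homotopy group `π_{j-i}`. -/
def stablePiMap (i j : ℕ) {X Y : Spectrum} (f : X ⟶ Y) : stablePi i j X → stablePi i j Y :=
  (Limits.colimMap (piSeqMap i j f) : _ ⟶ _)

/-- The stable equivalences of spectra: the maps that induce isomorphisms on all stable homotopy
groups `π_m`, `m ∈ ℤ`. The homotopy groups are computed after replacing the source and the target,
up to levelwise weak equivalence, by spectra whose levels are Kan complexes. -/
def IsStableEquiv {X Y : Spectrum} (f : X ⟶ Y) : Prop :=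
  ∃ (X' Y' : Spectrum) (a : X ⟶ X') (b : Y ⟶ Y') (f' : X' ⟶ Y'),
    a ≫ f' = f ≫ b ∧ IsLevelEquiv a ∧ IsLevelEquiv b ∧ X'.IsLevelKan ∧ Y'.IsLevelKan ∧
      ∀ i j : ℕ, Function.Bijective (stablePiMap i j f')

end Spectrum

/-! ### Homotopy limits -/

section Holim

variable {C D : Type} [SmallCategory C] [SmallCategory D]

/-- The diagram of simplicial sets `c ↦ N(C/c)`. -/
def overNerve (C : Type) [SmallCategory C] : C ⥤ SSet.{0} := Over.mapFunctor C ⋙ nerveFunctor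

/-- The diagram of simplicial sets `c ↦ Δ[n] × N(C/c)`. -/
abbrev simplexOverNerve (C : Type) [SmallCategory C] (n : SimplexCategory) : C ⥤ SSet.{0} :=
  overNerve C ⋙ tensorLeft (SSet.stdSimplex.obj n)

/-- The map of diagrams `Δ[n] × N(C/·) ⟶ Δ[m] × N(C/·)` induced by `[n] ⟶ [m]`. -/
abbrev simplexOverNerveMap (C : Type) [SmallCategory C] {n m : SimplexCategory} (θ : n ⟶ m) :
    simplexOverNerve C n ⟶ simplexOverNerve C m :=
  Functor.whiskerLeft (overNerve C) ((tensoringLeft SSet.{0}).map (SSet.stdSimplex.map θ))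

/-- The constant map of diagrams to the base points. -/
def constPt (X : C ⥤ PSSet) (W : C ⥤ SSet.{0}) : W ⟶ X ⋙ PSSet.forget where
  app c := SSet.const (X.obj c).pt
  naturality _ _ g := (PSSet.const_comp (X.map g)).symm

/-- The Bousfield--Kan homotopy limit of a diagram `X` of pointed simplicial sets: the space of
natural maps from the diagram `c ↦ N(C/c)` to `X`. An `n`-simplex is a natural family of maps
`Δ[n] × N(C/c) ⟶ X(c)`; the base point is the constant family. -/
def holimPSSet (X : C ⥤ PSSet) : PSSet where
  X :=
    { obj n := simplexOverNerve C n.unop ⟶ X ⋙ PSSet.forget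
      map θ := ↾fun α ↦ simplexOverNerveMap C θ.unop ≫ α
      map_id n := by
        refine ConcreteCategory.hom_ext _ _ fun α ↦ ?_
        change simplexOverNerveMap C (𝟙 n.unop) ≫ α = α
        rw [simplexOverNerveMap, stdSimplex_map_id, CategoryTheory.Functor.map_id]
        exact Category.id_comp _
      map_comp θ θ' := by
        refine ConcreteCategory.hom_ext _ _ fun α ↦ ?_
        change simplexOverNerveMap C (θ'.unop ≫ θ.unop) ≫ α =
          simplexOverNerveMap C θ'.unop ≫ simplexOverNerveMap C θ.unop ≫ α
        rw [simplexOverNerveMap, stdSimplex_map_comp, CategoryTheory.Functor.map_comp, Functor.whiskerLeft_comp]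
        exact Category.assoc _ _ _ }
  pt := constPt X _

/-- The map of diagrams `N(D/d) ⟶ N(C/F(d))`, `d ∈ D`, induced by a functor `F : D ⥤ C`. -/
def overNerveMap (F : D ⥤ C) : overNerve D ⟶ F ⋙ overNerve C where
  app d := nerveMap (Over.post F)
  naturality d e g := by
    have h : Over.map g ⋙ Over.post F = Over.post F ⋙ Over.map (F.map g) := by
      have hobj (k : Over d) : (Over.map g ⋙ Over.post F).obj k =
          (Over.post F ⋙ Over.map (F.map g)).obj k := congrArg Over.mk (F.map_comp k.hom g)
      have hleft {c : C} {A B : Over c} (hAB : A = B) :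
          (eqToHom hAB).left = eqToHom (congrArg (fun Z : Over c ↦ Z.left) hAB) := by
        subst hAB
        rfl
      refine CategoryTheory.Functor.ext hobj (fun k l u ↦ Over.OverMorphism.ext ?_)
      refine Eq.trans ?_ (congrArg₂ (fun p q ↦ p ≫ F.map u.left ≫ q)
        (hleft (hobj k)) (hleft (hobj l).symm)).symm
      exact ((Category.id_comp _).trans (Category.comp_id _)).symm
    exact congrArg nerveMap h

/-- The structure maps `holim Xₖ ∧ S¹ ⟶ holim Xₖ₊₁` of the homotopy limit of a diagram of spectra:
`(α, t)` is sent to the family `(u, y) ↦ σ_c (α_c (u, y), t (u))`. -/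
def holimStr (X : C ⥤ Spectrum) (k : ℕ) :
    PSSet.SuspMap (holimPSSet (X ⋙ Spectrum.levelFunctor k))
      (holimPSSet (X ⋙ Spectrum.levelFunctor (k + 1))) where
  map :=
    { app n := ↾fun p ↦
        { app c := CartesianMonoidalCategory.lift (p.1.app c)
              (CartesianMonoidalCategory.fst _ _ ≫ SSet.yonedaEquiv.symm p.2) ≫
            ((X.obj c).str k).map
          naturality c d g := by
            have h := p.1.naturality g
            have h' := (X.map g).comm k
            change _ = (CartesianMonoidalCategory.lift (p.1.app c)
              (CartesianMonoidalCategory.fst _ _ ≫ SSet.yonedaEquiv.symm p.2) ≫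
                ((X.obj c).str k).map) ≫ ((X.map g).f (k + 1)).map
            refine Eq.trans ?_ (congrArg (CartesianMonoidalCategory.lift (p.1.app c)
              (CartesianMonoidalCategory.fst _ _ ≫ SSet.yonedaEquiv.symm p.2) ≫ ·) h').symm
            have h2 : CartesianMonoidalCategory.lift
                ((simplexOverNerve C n.unop).map g ≫ p.1.app d)
                (CartesianMonoidalCategory.fst _ _ ≫ SSet.yonedaEquiv.symm p.2) =
              CartesianMonoidalCategory.lift (p.1.app c)
                (CartesianMonoidalCategory.fst _ _ ≫ SSet.yonedaEquiv.symm p.2) ≫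
                ((X.map g).f k).map ▷ Δ[1] := by
              rw [h]
              rfl
            exact congrArg (· ≫ ((X.obj d).str k).map) h2 }
      naturality n m θ := by
        refine ConcreteCategory.hom_ext _ _ fun p ↦ NatTrans.ext (funext fun c ↦ ?_)
        change CartesianMonoidalCategory.lift ((simplexOverNerveMap C θ.unop).app c ≫ p.1.app c)
            (CartesianMonoidalCategory.fst _ _ ≫ SSet.yonedaEquiv.symm (Δ[1].map θ p.2)) ≫ _ =
          (simplexOverNerveMap C θ.unop).app c ≫ CartesianMonoidalCategory.lift (p.1.app c)
            (CartesianMonoidalCategory.fst _ _ ≫ SSet.yonedaEquiv.symm p.2) ≫ _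
        rw [← map_comp_yonedaEquiv_symm]
        rfl }
  map_zero := by
    ext n α
    refine NatTrans.ext (funext fun c ↦ ?_)
    exact congrArg (α.app c ≫ ·) ((X.obj c).str k).map_zero
  map_one := by
    ext n α
    refine NatTrans.ext (funext fun c ↦ ?_)
    exact congrArg (α.app c ≫ ·) ((X.obj c).str k).map_one
  map_pt := by
    ext n t
    refine NatTrans.ext (funext fun c ↦ ?_)
    exact congrArg ((CartesianMonoidalCategory.fst _ _ ≫ SSet.yonedaEquiv.symm t) ≫ ·)
      ((X.obj c).str k).map_pt

/-- The homotopy limit of a diagram of spectra, formed levelwise. It is the homotopically correct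
one for diagrams of fibrant spectra. -/
def holim (X : C ⥤ Spectrum) : Spectrum where
  level k := holimPSSet (X ⋙ Spectrum.levelFunctor k)
  str k := holimStr X k

/-- The canonical map `F^* : holim_C X ⟶ holim_D (X ∘ F)` for a functor `F : D ⥤ C`: restriction
along `F` and along the maps `N(D/d) ⟶ N(C/F(d))`. -/
def holimRestrict (F : D ⥤ C) (X : C ⥤ Spectrum) : holim X ⟶ holim (F ⋙ X) where
  f k :=
    { map :=
        { app n := ↾fun α ↦
            Functor.whiskerRight (overNerveMap F) (tensorLeft (SSet.stdSimplex.obj n.unop)) ≫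
              Functor.whiskerLeft F α
          naturality n m θ := by
            ext α
            rfl }
      map_pt := by
        rfl }
  comm k := by
    rfl

/-- `r : X ⟶ X'` replaces each vertex of the diagram of spectra `X` by a fibrant spectrum:
`X'` is a diagram of fibrant spectra and `r` is a natural stable equivalence. -/
def IsFibrantReplacement {X X' : C ⥤ Spectrum} (r : X ⟶ X') : Prop :=
  ∀ c, (X'.obj c).IsFibrant ∧ Spectrum.IsStableEquiv (r.app c)

/-- A functor `F : D ⥤ C` is left cofinal if for each object `c` of `C` the left fiber `F/c`
(with objects `(d, F(d) ⟶ c)`) has contractible nerve. -/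
def IsLeftCofinal (F : D ⥤ C) : Prop :=
  ∀ c : C, IsContractible (nerve (CostructuredArrow F c))

end Holim

/-! ### The categories `P`, `Pⁿ`, `Δ`, `Δ^{<n}` and the functors `f`, `fⁿ` -/

/-- The partially ordered set of nonempty finite subsets of `S`. -/
abbrev FinSub (S : Set ℕ) : Type := { T : Finset ℕ // T.Nonempty ∧ (T : Set ℕ) ⊆ S }

/-- `P`: the nonempty finite subsets of `{1, 2, 3, …}`, ordered by inclusion. -/
abbrev P : Type := FinSub (Set.Ici 1)

/-- `Pⁿ`: the nonempty subsets of `{1, …, n}`, ordered by inclusion. -/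
abbrev Pn (n : ℕ) : Type := FinSub (Set.Icc 1 n)

lemma FinSub.card_eq {S : Set ℕ} (T : FinSub S) : T.1.card = (T.1.card - 1) + 1 :=
  (Nat.succ_pred_eq_of_pos (Finset.card_pos.2 T.2.1)).symm

/-- For `T = {t₀ < ⋯ < t_q}`, the order isomorphism `{0 < ⋯ < q} ≃ T`, `i ↦ tᵢ`. -/
def FinSub.enum {S : Set ℕ} (T : FinSub S) : Fin ((T.1.card - 1) + 1) ≃o T.1 :=
  T.1.orderIsoOfFin T.card_eq

/-- The functor that sends `T = {t₀ < ⋯ < t_q}` to `[q]`, `q = |T| - 1`, and an inclusion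
`T ⊆ T'` to the corresponding injective order-preserving map. -/
def toSimplex (S : Set ℕ) : FinSub S ⥤ SimplexCategory where
  obj T := SimplexCategory.mk (T.1.card - 1)
  map {T T'} g := SimplexCategory.mkHom
    { toFun i := T'.enum.symm ⟨(T.enum i).1, leOfHom g (T.enum i).2⟩
      monotone' i j hij := T'.enum.symm.monotone (T.enum.monotone hij) }
  map_id T := by
    ext i : 3
    exact T.enum.symm_apply_apply i
  map_comp {T T' T''} g h := by
    ext i : 3
    change T''.enum.symm _ = T''.enum.symm ⟨(T'.enum (T'.enum.symm _)).1, _⟩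
    simp

/-- The functor `f : P ⥤ Δ`. -/
def toDelta : P ⥤ SimplexCategory := toSimplex _

/-- `Δ^{<n}`: the full subcategory of `Δ` on the objects `[q]` with `q < n`. -/
abbrev DeltaLT (n : ℕ) : Type :=
  ObjectProperty.FullSubcategory (fun q : SimplexCategory ↦ q.len < n)

/-- The functor `fⁿ : Pⁿ ⥤ Δ^{<n}`, the restriction of `f`. -/
def toDeltaLT (n : ℕ) : Pn n ⥤ DeltaLT n :=
  ObjectProperty.lift _ (toSimplex _) (fun T ↦ by
    have h := Finset.card_le_card (fun t ht ↦ Finset.mem_Icc.2 (T.2.2 ht) : T.1 ⊆ Finset.Icc 1 n)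
    have h' := T.card_eq
    rw [Nat.card_Icc] at h
    change T.1.card - 1 < n
    omega)

end

end CosimplicialDescent

open CosimplicialDescent

/-!
A vertex of the homotopy limit of `X` over `C` is a map to `X` from the diagram `c ↦ N(C/c)`, which
is projectively cofibrant: it is built from free diagrams, with one cell for every nondegenerate
simplex of `N(C)`. For `F : D ⥤ C`, maps `N(D/·) ⟶ F ⋙ X` are the same as maps `N(F/·) ⟶ X`, so
`N(F/·)` is projectively cofibrant too, and its values are contractible if `F` is left cofinal. Thus
`N(F/·) ⟶ N(C/·)` is a map between cofibrant resolutions of the point, and restriction along `F` is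
bijective on homotopy classes of maps to objectwise Kan diagrams, that is, on `π₀` of the homotopy
limits. Loops commute with homotopy limits, so it is bijective on all homotopy groups of all levels.

An object `g : T ⟶ {0, …, q}` of the left fiber of `P ⥤ Δ` over `[q]` amounts to its graph, a chain
in `S × {0, …, q}` for the order `(t, a) < (t', a')` given by `t < t'` and `a ≤ a'`. The complex of
chains contracts: move the points one column `a` at a time first below, and then onto, the diagonal
`t = a + 1`, which is itself a chain and hence a simplex.
-/

namespace CosimplicialDescent

noncomputable section

open Limits HomotopicalAlgebra SSet.modelCategoryQuillen MorphismProperty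

/-! ### Anodyne maps of diagrams -/

lemma kanComplex_of_hornFilling {K : SSet.{0}}
    (h : ∀ (n : ℕ) (i : Fin (n + 2)) (σ₀ : (Λ[n + 1, i] : SSet.{0}) ⟶ K),
      ∃ σ : Δ[n + 1] ⟶ K, Λ[n + 1, i].ι ≫ σ = σ₀) : SSet.KanComplex K := by
  refine (isFibrant_iff _).2 ⟨?_⟩
  rw [fibrations_eq]
  intro _ _ _ hf
  simp only [J, MorphismProperty.iSup_iff] at hf
  obtain ⟨n, ⟨i⟩⟩ := hf
  refine ⟨fun {t _} _ ↦ ?_⟩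
  obtain ⟨φ, hφ⟩ := h _ _ t
  exact ⟨⟨{ l := φ, fac_left := hφ, fac_right := by subsingleton }⟩⟩

section AnodyneDiagrams

variable {C : Type} [SmallCategory C]

/-- The generating projective trivial cofibrations of diagrams of simplicial sets: the free
diagrams on the horn inclusions. -/
def diagramJ (C : Type) [SmallCategory C] : MorphismProperty (C ⥤ SSet.{0}) :=
  .ofHoms (fun (x : C × (Σ n : ℕ, Fin (n + 2))) ↦
    (evaluationLeftAdjoint SSet.{0} x.1).map Λ[x.2.1 + 1, x.2.2].ι)

attribute [local instance] Cardinal.fact_isRegular_aleph0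
  Cardinal.orderBotAleph0OrdToType

instance : MorphismProperty.IsSmall.{0} (diagramJ C) :=
  isSmall_ofHoms ..

instance : IsCardinalForSmallObjectArgument (diagramJ C) Cardinal.aleph0.{0} where
  preservesColimit {A B X Y} i hi f hf := by
    have : IsFinitelyPresentable.{0} A := by
      obtain ⟨c, n, i⟩ := hi
      exact (evaluationAdjunctionRight SSet.{0} c).isCardinalPresentable_leftAdjoint_obj _ _
    infer_instance

instance : HasSmallObjectArgument.{0} (diagramJ C) :=
  ⟨.aleph0, inferInstance, inferInstance, inferInstance⟩

lemma diagramJ_rlp_iff {E B : C ⥤ SSet.{0}} (p : E ⟶ B) :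
    (diagramJ C).rlp p ↔ ∀ c, Fibration (p.app c) := by
  constructor
  · intro h c
    rw [SSet.modelCategoryQuillen.fibration_iff]
    intro _ _ _ hf
    simp only [J, MorphismProperty.iSup_iff] at hf
    obtain ⟨n, ⟨i⟩⟩ := hf
    exact ((evaluationAdjunctionRight SSet.{0} c).hasLiftingProperty_iff _ p).1
      (h _ (ofHoms.mk (ι := C × (Σ n : ℕ, Fin (n + 2))) (c, ⟨n, i⟩)))
  · rintro h _ _ _ ⟨c, n, i⟩
    have := h c
    exact ((evaluationAdjunctionRight SSet.{0} c).hasLiftingProperty_iff _ p).2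
      (inferInstanceAs (HasLiftingProperty Λ[n + 1, i].ι (p.app c)))

def isTerminalTerminalObj (c : C) : IsTerminal ((⊤_ (C ⥤ SSet.{0})).obj c) :=
  IsTerminal.isTerminalObj ((evaluation C SSet.{0}).obj c) _ terminalIsTerminal

lemma fibration_terminal_from_app_iff (X : C ⥤ SSet.{0}) (c : C) :
    Fibration ((terminal.from X).app c) ↔ SSet.KanComplex (X.obj c) := by
  rw [← (isTerminalTerminalObj c).hom_ext ((isTerminalTerminalObj c).from _)
    ((terminal.from X).app c)]
  exact (isFibrant_iff_of_isTerminal _ (isTerminalTerminalObj c)).symm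

/-- A map of diagrams with the left lifting property against all objectwise Kan fibrations, that
is, a trivial cofibration of the projective model structure. -/
def IsDiagramAnodyne {A B : C ⥤ SSet.{0}} (j : A ⟶ B) : Prop :=
  ∀ ⦃E B' : C ⥤ SSet.{0}⦄ (p : E ⟶ B'), (∀ c, Fibration (p.app c)) → HasLiftingProperty j p

lemma exists_isDiagramAnodyne_to_kanComplex (W : C ⥤ SSet.{0}) :
    ∃ (Z : C ⥤ SSet.{0}) (j : W ⟶ Z), IsDiagramAnodyne j ∧ ∀ c, SSet.KanComplex (Z.obj c) := by
  let d := MorphismProperty.factorizationData (diagramJ C).rlp.llp (diagramJ C).rlp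
    (terminal.from W)
  refine ⟨d.Z, d.i, fun E B' p hp ↦ d.hi p ((diagramJ_rlp_iff p).2 hp), fun c ↦ ?_⟩
  rw [← fibration_terminal_from_app_iff, terminal.hom_ext (terminal.from d.Z) d.p]
  exact (diagramJ_rlp_iff _).1 d.hp c

lemma IsDiagramAnodyne.exists_extension {A A' X : C ⥤ SSet.{0}} {j : A ⟶ A'}
    (hj : IsDiagramAnodyne j) (hX : ∀ c, SSet.KanComplex (X.obj c)) (f : A ⟶ X) :
    ∃ g : A' ⟶ X, j ≫ g = f := by
  have := hj (terminal.from X) fun c ↦ (fibration_terminal_from_app_iff X c).2 (hX c)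
  have sq : CommSq f j (terminal.from X) (terminal.from A') := ⟨by simp⟩
  exact ⟨sq.lift, sq.fac_left⟩

lemma IsDiagramAnodyne.app {A B : C ⥤ SSet.{0}} {j : A ⟶ B} (hj : IsDiagramAnodyne j) (c : C) :
    SSet.anodyneExtensions (j.app c) := by
  intro E' B' p hp
  refine ((evaluationAdjunctionLeft SSet.{0} c).hasLiftingProperty_iff j p).2 (hj _ fun c' ↦ ?_)
  rw [SSet.modelCategoryQuillen.fibration_iff]
  have h : (Limits.Pi.lift fun g : c' ⟶ c ↦ Pi.π (fun _ : c' ⟶ c ↦ E') g ≫ p) =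
      Limits.Pi.map (fun _ : c' ⟶ c ↦ p) := by
    refine Limits.Pi.hom_ext _ _ fun g ↦ ?_
    rw [Limits.Pi.map_π, Limits.Pi.lift_π]
  change J.rlp (Limits.Pi.lift fun g : c' ⟶ c ↦ Pi.π (fun _ : c' ⟶ c ↦ E') g ≫ p)
  rw [h]
  exact MorphismProperty.limMap (W := J.rlp) _ fun _ ↦ hp

end AnodyneDiagrams

/-! ### Acyclic Kan complexes -/

lemma rlp_I_pre_of_unionProd {Y : SSet.{0}} (A : Y.Subcomplex) (X : SSet.{0})
    (h : ∀ n : ℕ, HasLiftingProperty (A.unionProd ∂Δ[n]).ι (terminal.from X)) :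
    I.rlp ((MonoidalClosed.pre A.ι).app X) := by
  suffices h' : ∀ n : ℕ, HasLiftingProperty ∂Δ[n].ι ((MonoidalClosed.pre A.ι).app X) by
    rintro _ _ _ ⟨n⟩
    exact h' n
  intro n
  exact (MonoidalClosed.internalHomAdjunction₂.hasLiftingProperty_iff
    (SSet.Subcomplex.unionProd.pushoutObjObj A ∂Δ[n])
    (Functor.PullbackObjObj.ofIsTerminal
      MonoidalClosed.internalHom A.ι (terminal.from X) terminalIsTerminal)).1 (h n)

lemma rlp_I_pre_of_anodyneExtensions {Y : SSet.{0}} (A : Y.Subcomplex)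
    (hA : SSet.anodyneExtensions A.ι) (X : SSet.{0}) [hX : SSet.KanComplex X] :
    I.rlp ((MonoidalClosed.pre A.ι).app X) :=
  rlp_I_pre_of_unionProd A X fun n ↦ SSet.anodyneExtensions_unionProd_ι' A ∂Δ[n] hA _
    ((isFibrant_iff X).1 hX).mem

/-- A simplicial set with the extension property for all monomorphisms. -/
def IsAcyclicKan (Z : SSet.{0}) : Prop :=
  ∀ ⦃A B : SSet.{0}⦄ (i : A ⟶ B) [Mono i] (f : A ⟶ Z), ∃ g : B ⟶ Z, i ≫ g = f

lemma IsAcyclicKan.rlp_monomorphisms {Z : SSet.{0}} (hZ : IsAcyclicKan Z) {T : SSet.{0}}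
    (hT : IsTerminal T) (p : Z ⟶ T) : (monomorphisms SSet.{0}).rlp p := by
  intro _ _ i (hi : Mono i)
  refine ⟨fun {f _} _ ↦ ?_⟩
  obtain ⟨g, hg⟩ := hZ i f
  exact ⟨⟨{ l := g, fac_left := hg, fac_right := hT.hom_ext _ _ }⟩⟩

lemma IsAcyclicKan.rlp_I_pre {Z : SSet.{0}} (hZ : IsAcyclicKan Z) {Y : SSet.{0}}
    (A : Y.Subcomplex) : I.rlp ((MonoidalClosed.pre A.ι).app Z) :=
  rlp_I_pre_of_unionProd A Z fun n ↦ hZ.rlp_monomorphisms terminalIsTerminal _ _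
    (inferInstanceAs (Mono (A.unionProd ∂Δ[n]).ι))

/-! ### Homotopies parametrized by `Δ[1] × A` -/

lemma const_mem_boundary_one (k : Fin 2) (m : SimplexCategoryᵒᵖ) :
    SSet.stdSimplex.const 1 k m ∈ (∂Δ[1] : Δ[1].Subcomplex).obj m := by
  intro hs
  obtain ⟨_, hi⟩ := hs 0
  obtain ⟨_, hj⟩ := hs 1
  exact zero_ne_one (hi.symm.trans hj : (0 : Fin 2) = 1)

lemma eq_const_of_boundary_one {m : SimplexCategoryᵒᵖ} (s : (∂Δ[1] : SSet.{0}).obj m) :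
    s.1 = SSet.stdSimplex.const 1 (SSet.stdSimplex.asOrderHom s.1 0) m := by
  apply SSet.stdSimplex.objEquiv.injective
  ext i : 3
  change SSet.stdSimplex.asOrderHom s.1 i = SSet.stdSimplex.asOrderHom s.1 0
  by_contra h
  refine s.2 fun y ↦ ?_
  by_cases hy : SSet.stdSimplex.asOrderHom s.1 i = y
  · exact ⟨i, hy⟩
  · exact ⟨0, by omega⟩

lemma const_mem_horn_one_zero (m : SimplexCategoryᵒᵖ) :
    SSet.stdSimplex.const 1 0 m ∈ (Λ[1, 0] : Δ[1].Subcomplex).obj m := by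
  refine (SSet.mem_horn_iff _ _).2 fun h ↦ ?_
  obtain ⟨_, hi⟩ | h₁ := h.ge (Set.mem_univ 1)
  · exact zero_ne_one (hi : (0 : Fin 2) = 1)
  · exact one_ne_zero h₁

lemma eq_const_of_horn_one_zero {m : SimplexCategoryᵒᵖ} (s : (Λ[1, 0] : SSet.{0}).obj m) :
    s.1 = SSet.stdSimplex.const 1 0 m := by
  have hs := (SSet.mem_horn_iff 0 s.1).1 s.2
  apply SSet.stdSimplex.objEquiv.injective
  ext i : 3
  by_contra hi
  refine hs (Set.eq_univ_of_forall fun y ↦ ?_)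
  by_cases hy : y = 0
  · exact Or.inr hy
  · refine Or.inl ⟨i, ?_⟩
    rw [Fin.eq_one_of_ne_zero y hy]
    exact Fin.eq_one_of_ne_zero _ hi

/-- The map `∂Δ[1] × A ⟶ X` given by two maps `A ⟶ X`. -/
def boundaryPair {A X : SSet.{0}} (f g : A ⟶ X) : (∂Δ[1] : SSet.{0}) ⊗ A ⟶ X where
  app m := ↾fun x ↦ if SSet.stdSimplex.asOrderHom x.1.1 0 = 0 then f.app m x.2 else g.app m x.2
  naturality m m' θ := by
    ext x
    have h : SSet.stdSimplex.asOrderHom (Δ[1].map θ x.1.1) 0 =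
        SSet.stdSimplex.asOrderHom x.1.1 0 := by
      rw [eq_const_of_boundary_one x.1]
      rfl
    change (if SSet.stdSimplex.asOrderHom (Δ[1].map θ x.1.1) 0 = 0 then
        f.app m' (A.map θ x.2) else g.app m' (A.map θ x.2)) =
      X.map θ (if SSet.stdSimplex.asOrderHom x.1.1 0 = 0 then f.app m x.2 else g.app m x.2)
    rw [h]
    split_ifs
    · exact NatTrans.naturality_apply f θ x.2
    · exact NatTrans.naturality_apply g θ x.2

/-- The map `H : Δ[1] × A ⟶ X` is a homotopy from `f` to `g`. -/
def HasEnds {A X : SSet.{0}} (H : Δ[1] ⊗ A ⟶ X) (f g : A ⟶ X) : Prop :=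
  (∀ m (a : A.obj m), H.app m (SSet.stdSimplex.const 1 0 m, a) = f.app m a) ∧
    ∀ m (a : A.obj m), H.app m (SSet.stdSimplex.const 1 1 m, a) = g.app m a

lemma hasEnds_iff {A X : SSet.{0}} (H : Δ[1] ⊗ A ⟶ X) (f g : A ⟶ X) :
    HasEnds H f g ↔ ∂Δ[1].ι ▷ A ≫ H = boundaryPair f g := by
  constructor
  · rintro ⟨h₀, h₁⟩
    ext m ⟨s, a⟩
    change H.app m (s.1, a) =
      if SSet.stdSimplex.asOrderHom s.1 0 = 0 then f.app m a else g.app m a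
    have hs := eq_const_of_boundary_one s
    split_ifs with h
    · rw [h] at hs
      rw [hs, h₀]
    · rw [Fin.eq_one_of_ne_zero _ h] at hs
      rw [hs, h₁]
  · intro h
    have H_ends (k : Fin 2) (m : SimplexCategoryᵒᵖ) (a : A.obj m) :
        H.app m (SSet.stdSimplex.const 1 k m, a) = if k = 0 then f.app m a else g.app m a :=
      congrArg (fun φ : (∂Δ[1] : SSet.{0}) ⊗ A ⟶ X ↦ φ.app m (⟨_, const_mem_boundary_one k m⟩, a)) h
    exact ⟨fun m a ↦ by simpa using H_ends 0 m a, fun m a ↦ by simpa using H_ends 1 m a⟩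

section DiagramHomotopies

variable {C : Type} [SmallCategory C]

/-- Currying for diagrams of simplicial sets. -/
def curryDiagram {K : SSet.{0}} {A X : C ⥤ SSet.{0}} (H : A ⋙ tensorLeft K ⟶ X) :
    A ⟶ X ⋙ ihom K where
  app c := MonoidalClosed.curry (H.app c)
  naturality c d g := by
    refine (MonoidalClosed.curry_natural_left _ _).symm.trans ?_
    refine Eq.trans ?_ (MonoidalClosed.curry_natural_right _ _)
    exact congrArg MonoidalClosed.curry (H.naturality g)

/-- Uncurrying for diagrams of simplicial sets. -/
def uncurryDiagram {K : SSet.{0}} {A X : C ⥤ SSet.{0}} (H : A ⟶ X ⋙ ihom K) :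
    A ⋙ tensorLeft K ⟶ X where
  app c := MonoidalClosed.uncurry (H.app c)
  naturality c d g := by
    refine (MonoidalClosed.uncurry_natural_left _ _).symm.trans ?_
    refine Eq.trans ?_ (MonoidalClosed.uncurry_natural_right _ _)
    exact congrArg MonoidalClosed.uncurry (H.naturality g)

/-- The restriction map of function complexes, for a diagram. -/
def preDiagram {K L : SSet.{0}} (i : K ⟶ L) (X : C ⥤ SSet.{0}) : X ⋙ ihom L ⟶ X ⋙ ihom K :=
  Functor.whiskerLeft X (MonoidalClosed.pre i)

lemma uncurryDiagram_comp_preDiagram {K L : SSet.{0}} (i : K ⟶ L) {A X : C ⥤ SSet.{0}}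
    {l : A ⟶ X ⋙ ihom L} {b : A ⋙ tensorLeft K ⟶ X} (h : l ≫ preDiagram i X = curryDiagram b)
    (c : C) : i ▷ A.obj c ≫ (uncurryDiagram l).app c = b.app c := by
  refine (MonoidalClosed.uncurry_pre_app _ _ i).symm.trans ?_
  refine (congrArg MonoidalClosed.uncurry (congr_app h c)).trans ?_
  exact MonoidalClosed.uncurry_curry _

lemma exists_tensor_lift {K L : SSet.{0}} (i : K ⟶ L) {A A' : C ⥤ SSet.{0}} (j : A ⟶ A')
    (X : C ⥤ SSet.{0}) (hj : HasLiftingProperty j (preDiagram i X))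
    (a : A ⋙ tensorLeft L ⟶ X) (b : A' ⋙ tensorLeft K ⟶ X)
    (h : ∀ c, i ▷ A.obj c ≫ a.app c = K ◁ j.app c ≫ b.app c) :
    ∃ l : A' ⋙ tensorLeft L ⟶ X, (∀ c, L ◁ j.app c ≫ l.app c = a.app c) ∧
      ∀ c, i ▷ A'.obj c ≫ l.app c = b.app c := by
  have sq : CommSq (curryDiagram a) j (preDiagram i X) (curryDiagram b) := ⟨by
    ext c : 2
    exact (MonoidalClosed.curry_pre_app _ _).trans ((congrArg MonoidalClosed.curry (h c)).trans
      (MonoidalClosed.curry_natural_left _ _))⟩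
  refine ⟨uncurryDiagram sq.lift, fun c ↦ ?_, uncurryDiagram_comp_preDiagram i sq.fac_right⟩
  refine (MonoidalClosed.uncurry_natural_left _ _).symm.trans ?_
  refine (congrArg MonoidalClosed.uncurry (congr_app sq.fac_left c)).trans ?_
  exact MonoidalClosed.uncurry_curry _

/-- A projectively cofibrant diagram of simplicial sets: maps out of it lift along objectwise
trivial fibrations. -/
def IsCofibrantDiagram (A : C ⥤ SSet.{0}) : Prop :=
  ∀ ⦃E B : C ⥤ SSet.{0}⦄ (p : E ⟶ B), (∀ c, I.rlp (p.app c)) →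
    ∀ b : A ⟶ B, ∃ l : A ⟶ E, l ≫ p = b

lemma IsCofibrantDiagram.exists_tensor_lift {A : C ⥤ SSet.{0}} (hA : IsCofibrantDiagram A)
    {K L : SSet.{0}} (i : K ⟶ L) (X : C ⥤ SSet.{0})
    (hi : ∀ c, I.rlp ((MonoidalClosed.pre i).app (X.obj c))) (b : A ⋙ tensorLeft K ⟶ X) :
    ∃ l : A ⋙ tensorLeft L ⟶ X, ∀ c, i ▷ A.obj c ≫ l.app c = b.app c := by
  obtain ⟨l, hl⟩ := hA (preDiagram i X) hi (curryDiagram b)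
  exact ⟨uncurryDiagram l, uncurryDiagram_comp_preDiagram i hl⟩

/-- Two maps of diagrams are joined by a natural homotopy. -/
def DiagramHomotopic {A X : C ⥤ SSet.{0}} (f g : A ⟶ X) : Prop :=
  ∃ H : A ⋙ tensorLeft Δ[1] ⟶ X, ∀ c, HasEnds (H.app c) (f.app c) (g.app c)

lemma DiagramHomotopic.precomp {A A' X : C ⥤ SSet.{0}} {f g : A ⟶ X}
    (h : DiagramHomotopic f g) (k : A' ⟶ A) : DiagramHomotopic (k ≫ f) (k ≫ g) := by
  obtain ⟨H, hH⟩ := h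
  exact ⟨Functor.whiskerRight k _ ≫ H, fun c ↦
    ⟨fun m a ↦ (hH c).1 m ((k.app c).app m a), fun m a ↦ (hH c).2 m ((k.app c).app m a)⟩⟩

lemma DiagramHomotopic.postcomp {A X X' : C ⥤ SSet.{0}} {f g : A ⟶ X}
    (h : DiagramHomotopic f g) (k : X ⟶ X') : DiagramHomotopic (f ≫ k) (g ≫ k) := by
  obtain ⟨H, hH⟩ := h
  exact ⟨H ≫ k, fun c ↦
    ⟨fun m a ↦ congrArg ((k.app c).app m) ((hH c).1 m a),
      fun m a ↦ congrArg ((k.app c).app m) ((hH c).2 m a)⟩⟩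

/-- The map `∂Δ[1] × A ⟶ X` given by two maps of diagrams `A ⟶ X`. -/
def boundaryPairDiagram {A X : C ⥤ SSet.{0}} (f g : A ⟶ X) :
    A ⋙ tensorLeft (∂Δ[1] : SSet.{0}) ⟶ X where
  app c := boundaryPair (f.app c) (g.app c)
  naturality c d k := by
    ext m ⟨s, a⟩
    change (if SSet.stdSimplex.asOrderHom s.1 0 = 0 then (f.app d).app m ((A.map k).app m a) else
        (g.app d).app m ((A.map k).app m a)) =
      (X.map k).app m (if SSet.stdSimplex.asOrderHom s.1 0 = 0 then (f.app c).app m a else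
        (g.app c).app m a)
    split_ifs
    · exact ConcreteCategory.congr_hom (congr_app (f.naturality k) m) a
    · exact ConcreteCategory.congr_hom (congr_app (g.naturality k) m) a

lemma IsDiagramAnodyne.diagramHomotopic_of_precomp {A A' X : C ⥤ SSet.{0}} {j : A ⟶ A'}
    (hj : IsDiagramAnodyne j) (hX : ∀ c, SSet.KanComplex (X.obj c)) {f g : A' ⟶ X}
    (h : DiagramHomotopic (j ≫ f) (j ≫ g)) : DiagramHomotopic f g := by
  obtain ⟨H, hH⟩ := h
  obtain ⟨l, -, hl⟩ := exists_tensor_lift ∂Δ[1].ι j X (hj _ fun c ↦ by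
    have := hX c
    exact inferInstanceAs (Fibration ((MonoidalClosed.pre ∂Δ[1].ι).app (X.obj c)))) H
    (boundaryPairDiagram f g) (fun c ↦ (hasEnds_iff _ _ _).1 (hH c))
  exact ⟨l, fun c ↦ (hasEnds_iff _ _ _).2 (hl c)⟩

lemma IsCofibrantDiagram.nonempty_hom {A Z : C ⥤ SSet.{0}} (hA : IsCofibrantDiagram A)
    (hZ : ∀ c, IsAcyclicKan (Z.obj c)) : Nonempty (A ⟶ Z) := by
  obtain ⟨l, -⟩ := hA (terminal.from Z) (fun c ↦ by
    rw [← SSet.rlp_monomorphisms]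
    exact (hZ c).rlp_monomorphisms (isTerminalTerminalObj c) _) (terminal.from A)
  exact ⟨l⟩

lemma IsCofibrantDiagram.diagramHomotopic {A Z : C ⥤ SSet.{0}} (hA : IsCofibrantDiagram A)
    (hZ : ∀ c, IsAcyclicKan (Z.obj c)) (f g : A ⟶ Z) : DiagramHomotopic f g := by
  obtain ⟨l, hl⟩ := hA.exists_tensor_lift ∂Δ[1].ι Z (fun c ↦ (hZ c).rlp_I_pre _)
    (boundaryPairDiagram f g)
  exact ⟨l, fun c ↦ (hasEnds_iff _ _ _).2 (hl c)⟩

end DiagramHomotopies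

/-! ### Contractible Kan complexes -/

lemma exists_tensor_lift_sset {K L A A' X : SSet.{0}} (i : K ⟶ L) (j : A ⟶ A')
    (hj : HasLiftingProperty j ((MonoidalClosed.pre i).app X))
    (a : L ⊗ A ⟶ X) (b : K ⊗ A' ⟶ X) (h : i ▷ A ≫ a = K ◁ j ≫ b) :
    ∃ l : L ⊗ A' ⟶ X, L ◁ j ≫ l = a ∧ i ▷ A' ≫ l = b := by
  have sq : CommSq (MonoidalClosed.curry a) j ((MonoidalClosed.pre i).app X)
      (MonoidalClosed.curry b) := ⟨
    (MonoidalClosed.curry_pre_app _ _).trans ((congrArg MonoidalClosed.curry h).trans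
      (MonoidalClosed.curry_natural_left _ _))⟩
  refine ⟨MonoidalClosed.uncurry sq.lift, ?_, ?_⟩
  · rw [← MonoidalClosed.uncurry_natural_left, sq.fac_left, MonoidalClosed.uncurry_curry]
  · rw [← MonoidalClosed.uncurry_pre_app, sq.fac_right, MonoidalClosed.uncurry_curry]

/-- The inclusion `A ≅ {k} × A ⟶ Δ[1] × A`. -/
def cylinderEnd (A : SSet.{0}) (k : Fin 2) : A ⟶ Δ[1] ⊗ A :=
  CartesianMonoidalCategory.lift (SSet.const (SSet.stdSimplex.obj₀Equiv.symm k)) (𝟙 A)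

lemma exists_homotopy_extension {A B Z : SSet.{0}} [SSet.KanComplex Z] (i : A ⟶ B) [hi : Mono i]
    (H : Δ[1] ⊗ A ⟶ Z) (f : B ⟶ Z) (h : cylinderEnd A 0 ≫ H = i ≫ f) :
    ∃ l : Δ[1] ⊗ B ⟶ Z, Δ[1] ◁ i ≫ l = H ∧ cylinderEnd B 0 ≫ l = f := by
  have hr := rlp_I_pre_of_anodyneExtensions (Λ[1, 0] : Δ[1].Subcomplex)
    (SSet.anodyneExtensions.horn_ι 0) Z
  rw [← SSet.rlp_monomorphisms] at hr
  obtain ⟨l, hl, hl'⟩ := exists_tensor_lift_sset Λ[1, 0].ι i (hr i hi) H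
    (CartesianMonoidalCategory.snd _ _ ≫ f) (by
      ext m ⟨s, a⟩
      change H.app m (s.1, a) = f.app m (i.app m a)
      rw [eq_const_of_horn_one_zero s]
      exact ConcreteCategory.congr_hom (congr_app h m) a)
  refine ⟨l, hl, ?_⟩
  ext m b
  exact congrArg (fun φ : (Λ[1, 0] : SSet.{0}) ⊗ B ⟶ Z ↦
    φ.app m (⟨_, const_mem_horn_one_zero m⟩, b)) hl'

lemma isAcyclicKan_of_hasEnds {Z : SSet.{0}} [SSet.KanComplex Z] (z : Δ[0] ⟶ Z)
    {G : Δ[1] ⊗ Z ⟶ Z} (hG : HasEnds G (SSet.stdSimplex.isTerminalObj₀.from Z ≫ z) (𝟙 Z)) :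
    IsAcyclicKan Z := by
  intro A B i _ f
  obtain ⟨l, hl, -⟩ := exists_homotopy_extension i (Δ[1] ◁ f ≫ G)
    (SSet.stdSimplex.isTerminalObj₀.from B ≫ z) (by
      ext m a
      refine (hG.1 m (f.app m a)).trans ?_
      exact congrArg (fun φ : A ⟶ Δ[0] ↦ z.app m (φ.app m a))
        (SSet.stdSimplex.isTerminalObj₀.hom_ext (f ≫ SSet.stdSimplex.isTerminalObj₀.from Z)
          (i ≫ SSet.stdSimplex.isTerminalObj₀.from B)))
  refine ⟨cylinderEnd B 1 ≫ l, ?_⟩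
  ext m a
  exact (congrArg (fun φ : Δ[1] ⊗ A ⟶ Z ↦ φ.app m (SSet.stdSimplex.const 1 1 m, a)) hl).trans
    (hG.2 m (f.app m a))

lemma IsContractible.isAcyclicKan {W Z : SSet.{0}} (hW : IsContractible W) {j : W ⟶ Z}
    (hj : SSet.anodyneExtensions j) [SSet.KanComplex Z] : IsAcyclicKan Z := by
  obtain ⟨z, ⟨H⟩⟩ := (hW Z).1 j
  obtain ⟨G, -, hG⟩ := exists_tensor_lift_sset ∂Δ[1].ι j
    (hj _ ((SSet.modelCategoryQuillen.fibration_iff _).1 inferInstance))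
    ((β_ _ _).hom ≫ H.h) (boundaryPair (SSet.stdSimplex.isTerminalObj₀.from Z ≫ z) (𝟙 Z))
    ((hasEnds_iff _ (SSet.stdSimplex.isTerminalObj₀.from W ≫ z) j).1
      ⟨fun m a ↦ congrArg (fun φ : W ⟶ Z ↦ φ.app m a) H.h₀,
        fun m a ↦ congrArg (fun φ : W ⟶ Z ↦ φ.app m a) H.h₁⟩)
  exact isAcyclicKan_of_hasEnds z ((hasEnds_iff _ _ _).2 hG)

lemma isContractible_of_nullHomotopic {A : SSet.{0}} (a : A _⦋0⦌)
    (h : ∀ (K : SSet.{0}) [SSet.KanComplex K] (g : A ⟶ K),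
      ∃ x : K _⦋0⦌, Nonempty (SSet.Homotopy (SSet.const x) g)) : IsContractible A := by
  intro K _
  refine ⟨fun g ↦ ?_, fun f g ⟨H⟩ ↦ ?_⟩
  · obtain ⟨x, hx⟩ := h K g
    exact ⟨SSet.const x, hx⟩
  · let s : Δ[0] ⟶ A := SSet.yonedaEquiv.symm a
    have hs : s ≫ SSet.stdSimplex.isTerminalObj₀.from A = 𝟙 _ :=
      SSet.stdSimplex.isTerminalObj₀.hom_ext _ _
    have hc (k : Δ[0] ⟶ K) : s ≫ SSet.stdSimplex.isTerminalObj₀.from A ≫ k = k := by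
      rw [← Category.assoc, hs, Category.id_comp]
    exact ⟨
      { h := s ▷ Δ[1] ≫ H.h
        h₀ := by
          rw [SSet.ι₀_comp_assoc, H.h₀, hc]
          rfl
        h₁ := by
          rw [SSet.ι₁_comp_assoc, H.h₁, hc]
          rfl
        rel := by
          ext m ⟨⟨x, hx⟩, _⟩
          exact hx.elim }⟩

/-! ### Chains in comma categories -/

section Chains

variable {C D : Type} [SmallCategory C] [SmallCategory D] {F : D ⥤ C} {c : C}
  {n : SimplexCategoryᵒᵖ}

lemma costructuredArrow_chain_ext {x y : (nerve (CostructuredArrow F c)).obj n}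
    (h : x ⋙ CostructuredArrow.proj F c = y ⋙ CostructuredArrow.proj F c)
    (h' : ∀ i, F.map (eqToHom (Functor.congr_obj h i)) ≫ (y.obj i).hom = (x.obj i).hom) :
    x = y := by
  refine CategoryTheory.Functor.ext
    (fun i ↦ CostructuredArrow.obj_ext _ _ (Functor.congr_obj h i) (h' i)) fun i j f ↦
    CommaMorphism.ext ?_ (by subsingleton)
  rw [CategoryTheory.Comma.comp_left, CategoryTheory.Comma.comp_left,
    CategoryTheory.Comma.eqToHom_left, CategoryTheory.Comma.eqToHom_left]
  exact Functor.congr_hom h f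

variable (F) in
/-- The lift of a chain `σ` in `D` to the comma category `F/c` that is determined by an arrow
`F(d) ⟶ c` from the image of the last object `d` of `σ`. -/
def chainOver (σ : (nerve D).obj n) (u : F.obj (σ.obj (Fin.last _)) ⟶ c) :
    (nerve (CostructuredArrow F c)).obj n where
  obj i := CostructuredArrow.mk (F.map (σ.map (homOfLE (Fin.le_last i))) ≫ u)
  map {i j} f := CostructuredArrow.homMk (σ.map f) (by
    refine (Category.assoc _ _ _).symm.trans (congrArg (· ≫ u) ?_)
    exact (F.map_comp _ _).symm.trans (congrArg F.map (σ.map_comp _ _).symm))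
  map_id i := by
    ext
    exact σ.map_id i
  map_comp f g := by
    ext
    exact σ.map_comp f g

lemma chainOver_obj_last (σ : (nerve D).obj n) (u : F.obj (σ.obj (Fin.last _)) ⟶ c) :
    (chainOver F σ u).obj (Fin.last _) = CostructuredArrow.mk u := by
  refine congrArg CostructuredArrow.mk ((congrArg (F.map · ≫ u) (σ.map_id _)).trans ?_)
  rw [F.map_id, Category.id_comp]

lemma chainOver_proj (x : (nerve (CostructuredArrow F c)).obj n) :
    chainOver F ((nerveMap (CostructuredArrow.proj F c)).app n x) (x.obj (Fin.last _)).hom =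
      x := by
  refine costructuredArrow_chain_ext rfl fun i ↦ ?_
  refine ((congrArg (· ≫ _) (F.map_id _)).trans (Category.id_comp _)).trans ?_
  exact (CostructuredArrow.w (x.map (homOfLE (Fin.le_last i)))).symm

lemma nerveMap_map_chainOver {c' : C} (g : c ⟶ c') (σ : (nerve D).obj n)
    (u : F.obj (σ.obj (Fin.last _)) ⟶ c) :
    (nerveMap (CostructuredArrow.map g)).app n (chainOver F σ u) = chainOver F σ (u ≫ g) := by
  refine costructuredArrow_chain_ext rfl fun i ↦ ?_
  refine ((congrArg (· ≫ _) (F.map_id _)).trans (Category.id_comp _)).trans ?_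
  exact (Category.assoc _ _ _).symm

lemma costructuredArrow_chain_ext_last {x y : (nerve (CostructuredArrow F c)).obj n}
    (h : (nerveMap (CostructuredArrow.proj F c)).app n x =
      (nerveMap (CostructuredArrow.proj F c)).app n y)
    (h' : F.map (eqToHom (Functor.congr_obj h (Fin.last _))) ≫ (y.obj (Fin.last _)).hom =
      (x.obj (Fin.last _)).hom) : x = y := by
  have chainOver_congr (σ τ : (nerve D).obj n) (hστ : σ = τ) (u : F.obj (σ.obj (Fin.last _)) ⟶ c)
      (v : F.obj (τ.obj (Fin.last _)) ⟶ c)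
      (huv : F.map (eqToHom (Functor.congr_obj hστ (Fin.last _))) ≫ v = u) :
      chainOver F σ u = chainOver F τ v := by
    subst hστ
    rw [← huv, eqToHom_refl, F.map_id, Category.id_comp]
  rw [← chainOver_proj x, ← chainOver_proj y]
  exact chainOver_congr _ _ h _ _ h'

end Chains

/-! ### Cofibrancy of the diagram of nerves of over categories -/

section OverPullback

variable {D : Type} [SmallCategory D] {K K' K'' : SSet.{0}}

/-- The pullback of `overNerve D` along a map `τ : K ⟶ N(D)`, as a diagram on `D`: at `d` it
consists of the pairs of simplices of `K` and of `N(D/d)` with the same image in `N(D)`. -/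
def overPullback (τ : K ⟶ nerve D) : D ⥤ SSet.{0} where
  obj d :=
    { obj m := { y : K.obj m × (nerve (Over d)).obj m //
        τ.app m y.1 = (nerveMap (CostructuredArrow.proj (𝟭 D) d)).app m y.2 }
      map η := ↾fun y ↦ ⟨(K.map η y.1.1, (nerve (Over d)).map η y.1.2),
        (NatTrans.naturality_apply τ η y.1.1).trans (congrArg ((nerve D).map η) y.2)⟩
      map_id m := by
        ext y
        · exact ConcreteCategory.congr_hom (K.map_id m) y.1.1
        · rfl
      map_comp η η' := by
        ext y
        · exact ConcreteCategory.congr_hom (K.map_comp η η') y.1.1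
        · rfl }
  map g :=
    { app m := ↾fun y ↦ ⟨(y.1.1, (((overNerve D).map g).app m y.1.2)), y.2⟩ }
  map_id d := by
    ext m y
    · rfl
    · exact congrArg (fun φ : (overNerve D).obj d ⟶ _ ↦ φ.app m y.1.2) ((overNerve D).map_id d)
  map_comp {d d' d''} g g' := by
    ext m y
    · rfl
    · exact congrArg (fun φ : (overNerve D).obj d ⟶ (overNerve D).obj d'' ↦ φ.app m y.1.2)
        ((overNerve D).map_comp g g')

/-- The projection of the pullback to `overNerve D`. -/
def overPullbackProj (τ : K ⟶ nerve D) : overPullback τ ⟶ overNerve D where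
  app d := { app m := ↾fun y ↦ y.1.2 }

/-- The functoriality of `overPullback` for maps over `N(D)`. -/
def overPullbackMap (j : K ⟶ K') {τ : K ⟶ nerve D} {τ' : K' ⟶ nerve D} (h : j ≫ τ' = τ) :
    overPullback τ ⟶ overPullback τ' where
  app d :=
    { app m := ↾fun y ↦ ⟨(j.app m y.1.1, y.1.2),
        (congrArg (fun φ : K ⟶ nerve D ↦ φ.app m y.1.1) h).trans y.2⟩
      naturality m m' η := by
        ext y
        exact Subtype.ext (congrArg (·, (nerve (Over d)).map η y.1.2)
          (NatTrans.naturality_apply j η y.1.1)) }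

end OverPullback

section FreeDiagram

variable {D : Type} [SmallCategory D]

/-- The free diagram `d ↦ Hom(d₀, d) × K` on a simplicial set `K` placed at `d₀`. -/
def freeDiagram (d₀ : D) (K : SSet.{0}) : D ⥤ SSet.{0} :=
  (coyoneda.obj (op d₀) ⋙ (Functor.const _ : Type ⥤ SSet.{0})) ⋙ tensorRight K

/-- The functoriality of `freeDiagram` in the simplicial set. -/
def freeDiagramMap (d₀ : D) {K L : SSet.{0}} (i : K ⟶ L) :
    freeDiagram d₀ K ⟶ freeDiagram d₀ L :=
  Functor.whiskerLeft (coyoneda.obj (op d₀) ⋙ (Functor.const _ : Type ⥤ SSet.{0}))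
    ((tensoringRight SSet.{0}).map i)

/-- The inclusion of `K` into the free diagram at `d₀`. -/
def toFreeDiagram (d₀ : D) (K : SSet.{0}) : K ⟶ (freeDiagram d₀ K).obj d₀ where
  app m := ↾fun s ↦ (𝟙 d₀, s)

/-- The map out of the free diagram that extends a map out of `K`. -/
def freeDiagramDesc {d₀ : D} {K : SSet.{0}} {E : D ⥤ SSet.{0}} (f : K ⟶ E.obj d₀) :
    freeDiagram d₀ K ⟶ E where
  app d :=
    { app m := ↾fun y ↦ (E.map y.1).app m (f.app m y.2)
      naturality m m' η := by
        ext y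
        exact congrArg ((E.map y.1).app m') (NatTrans.naturality_apply f η y.2) |>.trans
          (NatTrans.naturality_apply (E.map y.1) η _) }
  naturality d d' g := by
    ext m y
    exact congrArg (fun φ : E.obj d₀ ⟶ E.obj d' ↦ φ.app m (f.app m y.2)) (E.map_comp y.1 g)

lemma toFreeDiagram_desc {d₀ : D} {K : SSet.{0}} {E : D ⥤ SSet.{0}} (f : K ⟶ E.obj d₀) :
    toFreeDiagram d₀ K ≫ (freeDiagramDesc f).app d₀ = f := by
  ext m s
  exact congrArg (fun φ : E.obj d₀ ⟶ E.obj d₀ ↦ φ.app m (f.app m s)) (E.map_id d₀)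

lemma freeDiagram_hom_ext {d₀ : D} {K : SSet.{0}} {E : D ⥤ SSet.{0}} {f g : freeDiagram d₀ K ⟶ E}
    (h : toFreeDiagram d₀ K ≫ f.app d₀ = toFreeDiagram d₀ K ≫ g.app d₀) : f = g := by
  have app_eq (f : freeDiagram d₀ K ⟶ E) {d : D} {m : SimplexCategoryᵒᵖ} (u : d₀ ⟶ d)
      (s : K.obj m) : (f.app d).app m (u, s) =
        (E.map u).app m ((toFreeDiagram d₀ K ≫ f.app d₀).app m s) :=
    (congrArg (fun v : d₀ ⟶ d ↦ (f.app d).app m (v, s)) (Category.id_comp u).symm).trans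
      (congrArg (fun φ : (freeDiagram d₀ K).obj d₀ ⟶ E.obj d ↦ φ.app m (𝟙 d₀, s))
        (f.naturality u))
  ext d m ⟨u, s⟩
  refine (app_eq f u s).trans (Eq.trans ?_ (app_eq g u s).symm)
  rw [h]

lemma hasLiftingProperty_freeDiagramMap {d₀ : D} {K L : SSet.{0}} (i : K ⟶ L)
    {E B : D ⥤ SSet.{0}} (p : E ⟶ B) [HasLiftingProperty i (p.app d₀)] :
    HasLiftingProperty (freeDiagramMap d₀ i) p where
  sq_hasLift {f g} sq := by
    have sq' : CommSq (toFreeDiagram d₀ K ≫ f.app d₀) i (p.app d₀)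
        (toFreeDiagram d₀ L ≫ g.app d₀) :=
      ⟨congrArg (toFreeDiagram d₀ K ≫ ·) (congr_app sq.w d₀)⟩
    refine ⟨⟨{ l := freeDiagramDesc sq'.lift, fac_left := ?_, fac_right := ?_ }⟩⟩
    · apply freeDiagram_hom_ext
      refine Eq.trans ?_ sq'.fac_left
      exact congrArg (i ≫ ·) (toFreeDiagram_desc sq'.lift)
    · apply freeDiagram_hom_ext
      refine Eq.trans ?_ sq'.fac_right
      exact congrArg (· ≫ p.app d₀) (toFreeDiagram_desc sq'.lift)

end FreeDiagram

section Cell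

variable {D : Type} [SmallCategory D]

lemma overPullback_ext {K : SSet.{0}} {τ : K ⟶ nerve D} {d : D} {m : SimplexCategoryᵒᵖ}
    {y z : ((overPullback τ).obj d).obj m} (h : y.1.1 = z.1.1) (h' : y.1.2 = z.1.2) : y = z :=
  Subtype.ext (Prod.ext h h')

/-- The map to the pullback that is given by a lift of `τ : K ⟶ N(D)` to `N(D/d)`. -/
def overPullbackLift {K : SSet.{0}} {τ : K ⟶ nerve D} {d : D} (φ : K ⟶ nerve (Over d))
    (h : φ ≫ nerveMap (CostructuredArrow.proj (𝟭 D) d) = τ) : K ⟶ (overPullback τ).obj d where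
  app m := ↾fun s ↦ ⟨(s, φ.app m s), congrArg (fun ψ : K ⟶ nerve D ↦ ψ.app m s) h.symm⟩
  naturality m m' η := by
    ext s
    refine overPullback_ext rfl ?_
    exact NatTrans.naturality_apply φ η s

variable {n : ℕ} (τ : Δ[n] ⟶ nerve D)

/-- The last object of the chain in `D` classified by `τ : Δ[n] ⟶ N(D)`. -/
def lastObj : D := (SSet.yonedaEquiv τ).obj (Fin.last n)

/-- The lift of `τ : Δ[n] ⟶ N(D)` to `N(D/d₀)`, with `d₀` the last object of the chain `τ`. -/
def toOverLast : Δ[n] ⟶ nerve (Over (lastObj τ)) :=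
  SSet.yonedaEquiv.symm (chainOver (𝟭 D) (SSet.yonedaEquiv τ) (𝟙 (lastObj τ)))

lemma toOverLast_proj :
    toOverLast τ ≫ nerveMap (CostructuredArrow.proj (𝟭 D) (lastObj τ)) = τ :=
  (SSet.yonedaEquiv_symm_comp _ _).trans (SSet.yonedaEquiv.symm_apply_apply τ)

/-- The cell of `overPullback (i ≫ τ)` generated by the lift `toOverLast τ`. -/
def cellMap {K : SSet.{0}} (i : K ⟶ Δ[n]) :
    freeDiagram (lastObj τ) K ⟶ overPullback (i ≫ τ) :=
  freeDiagramDesc (overPullbackLift (i ≫ toOverLast τ)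
    ((Category.assoc _ _ _).trans (congrArg (i ≫ ·) (toOverLast_proj τ))))

lemma cellMap_app {K : SSet.{0}} (i : K ⟶ Δ[n]) {d : D} (m : SimplexCategoryᵒᵖ)
    (u : lastObj τ ⟶ d) (s : K.obj m) :
    (((cellMap τ i).app d).app m (u, s)).1 = (s, (nerve (Over d)).map
      (SSet.stdSimplex.objEquiv (i.app m s)).op (chainOver (𝟭 D) (SSet.yonedaEquiv τ) u)) := by
  refine Prod.ext rfl ?_
  refine congrArg ((nerve (Over d)).map _) ((nerveMap_map_chainOver u _ _).trans ?_)
  exact congrArg (chainOver (𝟭 D) (SSet.yonedaEquiv τ)) (Category.id_comp u)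

lemma cellMap_comp {K : SSet.{0}} (i : K ⟶ Δ[n]) :
    cellMap τ i ≫ overPullbackMap i rfl =
      freeDiagramMap (lastObj τ) i ≫ cellMap τ (𝟙 Δ[n]) := by
  ext d m ⟨u, s⟩
  refine Subtype.ext ?_
  refine (congrArg (Prod.map (i.app m) id) (cellMap_app τ i m u s)).trans ?_
  exact (cellMap_app τ (𝟙 Δ[n]) m u (i.app m s)).symm

variable {d : D} {m : SimplexCategoryᵒᵖ} {s : (Δ[n] : SSet.{0}).obj m}

lemma cellMap_injective_of_notMem_boundary (hs : s ∉ (∂Δ[n] : SSet.Subcomplex _).obj m)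
    {u v : lastObj τ ⟶ d}
    (h : ((cellMap τ (𝟙 Δ[n])).app d).app m (u, s) =
      ((cellMap τ (𝟙 Δ[n])).app d).app m (v, s)) : u = v := by
  obtain ⟨i, hi⟩ := not_not.1 hs (Fin.last n)
  have hchain : (nerve (Over d)).map (SSet.stdSimplex.objEquiv s).op
      (chainOver (𝟭 D) (SSet.yonedaEquiv τ) u) =
        (nerve (Over d)).map (SSet.stdSimplex.objEquiv s).op
          (chainOver (𝟭 D) (SSet.yonedaEquiv τ) v) :=
    congrArg Prod.snd (((cellMap_app τ (𝟙 _) m u s).symm.trans (congrArg Subtype.val h)).trans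
      (cellMap_app τ (𝟙 _) m v s))
  have hlast : (chainOver (𝟭 D) (SSet.yonedaEquiv τ) u).obj (Fin.last n) =
      (chainOver (𝟭 D) (SSet.yonedaEquiv τ) v).obj (Fin.last n) :=
    hi ▸ Functor.congr_obj hchain i
  have hmk : Over.mk u = Over.mk v :=
    (chainOver_obj_last (F := 𝟭 D) (n := op ⦋n⦌) _ u).symm.trans
      (hlast.trans (chainOver_obj_last (F := 𝟭 D) (n := op ⦋n⦌) _ v))
  injection hmk with _ _ huv

lemma exists_cellMap_eq_of_notMem_boundary (y : ((overPullback τ).obj d).obj m)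
    (hy : y.1.1 ∉ (∂Δ[n] : SSet.Subcomplex _).obj m) :
    ∃ u : lastObj τ ⟶ d, ((cellMap τ (𝟙 Δ[n])).app d).app m (u, y.1.1) = y := by
  have hlast : (SSet.stdSimplex.objEquiv y.1.1).toOrderHom (Fin.last _) = Fin.last n := by
    obtain ⟨i, hi⟩ := not_not.1 hy (Fin.last n)
    exact Fin.last_le_iff.1 (hi.symm.le.trans (OrderHom.monotone _ (Fin.le_last i)))
  have hproj : (nerve D).map (SSet.stdSimplex.objEquiv y.1.1).op (SSet.yonedaEquiv τ) =
      (nerveMap (CostructuredArrow.proj (𝟭 D) d)).app m y.1.2 :=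
    (SSet.stdSimplex.map_objEquiv_op_apply _ _).trans
      ((congrArg (fun ψ : Δ[n] ⟶ nerve D ↦ ψ.app m y.1.1)
        (SSet.yonedaEquiv.symm_apply_apply τ)).trans y.2)
  have hobj : lastObj τ = (y.1.2.obj (Fin.last _)).left :=
    (congrArg (SSet.yonedaEquiv τ).obj hlast.symm).trans (Functor.congr_obj hproj _)
  refine ⟨eqToHom hobj ≫ (y.1.2.obj (Fin.last _)).hom, overPullback_ext rfl ?_⟩
  refine (congrArg Prod.snd (cellMap_app τ (𝟙 _) m _ y.1.1)).trans
    (costructuredArrow_chain_ext_last hproj ?_)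
  have hmap : (SSet.yonedaEquiv τ).map (homOfLE (Fin.le_last _)) =
      eqToHom (congrArg (SSet.yonedaEquiv τ).obj hlast) :=
    (congrArg (SSet.yonedaEquiv τ).map (Subsingleton.elim _ (eqToHom hlast))).trans
      (eqToHom_map _ hlast)
  refine Eq.trans ?_ (congrArg (· ≫ eqToHom hobj ≫ (y.1.2.obj (Fin.last _)).hom) hmap).symm
  exact (eqToHom_trans_assoc _ _ _).symm

lemma isPushout_cellMap :
    IsPushout (cellMap τ (∂Δ[n] : SSet.Subcomplex _).ι)
      (freeDiagramMap (lastObj τ) (∂Δ[n] : SSet.Subcomplex _).ι)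
      (overPullbackMap (∂Δ[n] : SSet.Subcomplex _).ι rfl) (cellMap τ (𝟙 Δ[n])) := by
  refine .of_forall_isPushout_app fun d ↦ .of_forall_isPushout_app fun m ↦ ?_
  have hinj : Function.Injective (((overPullbackMap (∂Δ[n] : SSet.Subcomplex _).ι
      (rfl : _ ≫ τ = _)).app d).app m) := fun y z h ↦
    overPullback_ext (Subtype.ext (congrArg (·.1.1) h)) (congrArg (·.1.2) h)
  have := (mono_iff_injective _).2 hinj
  refine Types.isPushout_of_isPullback_of_mono' ((Types.isPullback_iff _ _ _ _).2
    ⟨congr_app (congr_app (cellMap_comp τ _) d) m, ?_, ?_⟩) ?_ ?_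
  · rintro ⟨u, s⟩ ⟨v, t⟩ ⟨-, h⟩
    exact Prod.ext (congrArg (·.1) h) (Subtype.ext (congrArg (·.2) h))
  · rintro y ⟨u, s⟩ h
    obtain rfl : y.1.1.1 = s := congrArg (·.1.1) h
    refine ⟨(u, y.1.1), hinj (Eq.trans ?_ h.symm), rfl⟩
    exact congrArg (fun φ : freeDiagram (lastObj τ) _ ⟶ overPullback τ ↦
      (φ.app d).app m (u, y.1.1)) (cellMap_comp τ _)
  · refine Set.eq_univ_of_forall fun y ↦ ?_
    by_cases hy : y.1.1 ∈ (∂Δ[n] : SSet.Subcomplex _).obj m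
    · exact Or.inl ⟨⟨(⟨y.1.1, hy⟩, y.1.2), y.2⟩, rfl⟩
    · obtain ⟨u, hu⟩ := exists_cellMap_eq_of_notMem_boundary τ y hy
      exact Or.inr ⟨(u, y.1.1), hu⟩
  · rintro ⟨u, s⟩ ⟨v, t⟩ hs - h
    obtain rfl : s = t := congrArg (·.1.1) h
    exact Prod.ext (cellMap_injective_of_notMem_boundary τ (fun hs' ↦ hs ⟨(u, ⟨s, hs'⟩), rfl⟩) h)
      rfl

end Cell

section PartialLifts

variable {D : Type} [SmallCategory D] {E B : D ⥤ SSet.{0}}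

lemma hasLiftingProperty_overPullbackMap_boundary {p : E ⟶ B} (hp : ∀ d, I.rlp (p.app d))
    {n : ℕ} (τ : Δ[n] ⟶ nerve D) :
    HasLiftingProperty (overPullbackMap (∂Δ[n] : SSet.Subcomplex _).ι (τ := _ ≫ τ) rfl) p :=
  have := hp (lastObj τ) _ (boundary_ι_mem_I n)
  have := hasLiftingProperty_freeDiagramMap (d₀ := lastObj τ) (∂Δ[n] : SSet.Subcomplex _).ι p
  (isPushout_cellMap τ).hasLiftingProperty p

variable (p : E ⟶ B) (b : overNerve D ⟶ B)

/-- A partial lift over `K` of `b : overNerve D ⟶ B` along `p : E ⟶ B`: a map `K ⟶ N(D)`, together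
with a lift of the restriction of `b` to the pullback of `overNerve D` along this map. -/
structure PartialLift (K : SSet.{0}) where
  map : K ⟶ nerve D
  lift : overPullback map ⟶ E
  lift_comp : lift ≫ p = overPullbackProj map ≫ b

namespace PartialLift

variable {p b} {K K' K'' : SSet.{0}}

lemma ext_of_overPullbackMap {t t' : PartialLift p b K} (h : t.map = t'.map)
    (h' : t.lift = overPullbackMap (𝟙 K) h.symm ≫ t'.lift) : t = t' := by
  obtain ⟨τ, l, h₁⟩ := t
  obtain ⟨τ', l', h₂⟩ := t'
  obtain rfl : τ = τ' := h
  obtain rfl : l = l' := h'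
  rfl

/-- The restriction of a partial lift along a map of simplicial sets. -/
def precomp (t : PartialLift p b K') (j : K ⟶ K') : PartialLift p b K where
  map := j ≫ t.map
  lift := overPullbackMap j rfl ≫ t.lift
  lift_comp := by
    rw [Category.assoc, t.lift_comp]
    rfl

lemma precomp_id (t : PartialLift p b K) : t.precomp (𝟙 K) = t :=
  ext_of_overPullbackMap (Category.id_comp _) rfl

lemma precomp_comp (t : PartialLift p b K'') (j : K ⟶ K') (j' : K' ⟶ K'') :
    t.precomp (j ≫ j') = (t.precomp j').precomp j :=
  ext_of_overPullbackMap (Category.assoc _ _ _) rfl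

end PartialLift

/-- The simplicial set of partial lifts over the standard simplices. Maps from `K` to it are the
partial lifts over `K`. -/
def partialLifts : SSet.{0} where
  obj n := PartialLift p b (SSet.stdSimplex.obj n.unop)
  map η := ↾fun t ↦ t.precomp (SSet.stdSimplex.map η.unop)
  map_id n := by
    ext t
    exact (congrArg t.precomp (stdSimplex_map_id n.unop)).trans t.precomp_id
  map_comp η η' := by
    ext t
    exact (congrArg t.precomp (stdSimplex_map_comp η'.unop η.unop)).trans (t.precomp_comp _ _)

/-- The map that sends a partial lift over `Δ[n]` to the chain in `D` over which it lies. -/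
def partialLiftsProj : partialLifts p b ⟶ nerve D where
  app n := ↾fun t ↦ SSet.yonedaEquiv t.map
  naturality n m η := by
    ext t
    exact (SSet.yonedaEquiv_naturality (g := t.map) η.unop).symm

namespace PartialLift

variable {p b} {K K' : SSet.{0}}

/-- The map `K ⟶ partialLifts p b` classifying a partial lift over `K`. -/
def classify (t : PartialLift p b K) : K ⟶ partialLifts p b where
  app n := ↾fun s ↦ t.precomp (SSet.yonedaEquiv.symm s)
  naturality n m η := by
    ext s
    exact (congrArg t.precomp (map_comp_yonedaEquiv_symm η s).symm).trans (t.precomp_comp _ _)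

lemma comp_classify (t : PartialLift p b K') (j : K ⟶ K') :
    j ≫ t.classify = (t.precomp j).classify := by
  ext n s
  exact (congrArg t.precomp (SSet.yonedaEquiv_symm_comp s j).symm).trans (t.precomp_comp _ _)

lemma classify_proj (t : PartialLift p b K) : t.classify ≫ partialLiftsProj p b = t.map := by
  ext n s
  refine (congrArg SSet.yonedaEquiv (SSet.yonedaEquiv_symm_comp s t.map)).trans ?_
  exact SSet.yonedaEquiv.apply_symm_apply _

/-- The value of a partial lift at a pair of compatible simplices. -/
def app (t : PartialLift p b K) {d : D} {m : SimplexCategoryᵒᵖ} (s : K.obj m)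
    (x : (nerve (Over d)).obj m)
    (h : t.map.app m s = (nerveMap (CostructuredArrow.proj (𝟭 D) d)).app m x) :
    (E.obj d).obj m :=
  (t.lift.app d).app m ⟨(s, x), h⟩

lemma app_congr {t t' : PartialLift p b K} (ht : t = t') {d : D} {m : SimplexCategoryᵒᵖ}
    {s s' : K.obj m} (hs : s = s') (x : (nerve (Over d)).obj m)
    (h : t.map.app m s = (nerveMap (CostructuredArrow.proj (𝟭 D) d)).app m x) :
    t.app s x h = t'.app s' x (by rw [← ht, ← hs, h]) := by
  subst ht
  subst hs
  rfl

end PartialLift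

variable {p b}

/-- The partial lift over `K` classified by a map `K ⟶ partialLifts p b`. -/
def universalPartialLift {K : SSet.{0}} (φ : K ⟶ partialLifts p b) : PartialLift p b K where
  map := φ ≫ partialLiftsProj p b
  lift :=
    { app d :=
        { app m := ↾fun y ↦ (φ.app m y.1.1).app (SSet.yonedaEquiv (𝟙 _)) y.1.2 y.2
          naturality m m' η := by
            ext y
            refine (PartialLift.app_congr (NatTrans.naturality_apply φ η y.1.1) rfl _ _).trans ?_
            refine Eq.trans ?_ (NatTrans.naturality_apply ((φ.app m y.1.1).lift.app d) η
              ⟨(SSet.yonedaEquiv (𝟙 _), y.1.2), y.2⟩)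
            exact PartialLift.app_congr rfl
              (SSet.yonedaEquiv_naturality η.unop (𝟙 (SSet.stdSimplex.obj m.unop))).symm _ _ }
      naturality d d' g := by
        ext m y
        exact ConcreteCategory.congr_hom (congr_app ((φ.app m y.1.1).lift.naturality g) m)
          ⟨(SSet.yonedaEquiv (𝟙 _), y.1.2), y.2⟩ }
  lift_comp := by
    ext d m y
    exact ConcreteCategory.congr_hom (congr_app (congr_app (φ.app m y.1.1).lift_comp d) m)
      ⟨(SSet.yonedaEquiv (𝟙 _), y.1.2), y.2⟩

lemma universalPartialLift_precomp {K : SSet.{0}} (φ : K ⟶ partialLifts p b)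
    {n : SimplexCategoryᵒᵖ} (s : K.obj n) :
    (universalPartialLift φ).precomp (SSet.yonedaEquiv.symm s) = φ.app n s := by
  have hmap : SSet.yonedaEquiv.symm s ≫ φ ≫ partialLiftsProj p b = (φ.app n s).map :=
    (SSet.yonedaEquiv_symm_comp s _).trans (SSet.yonedaEquiv.symm_apply_apply _)
  refine PartialLift.ext_of_overPullbackMap hmap ?_
  ext d m y
  let η := (SSet.stdSimplex.objEquiv y.1.1).op
  have hφ : φ.app m ((SSet.yonedaEquiv.symm s).app m y.1.1) =
      (φ.app n s).precomp (SSet.stdSimplex.map η.unop) := NatTrans.naturality_apply φ η s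
  exact (PartialLift.app_congr hφ rfl y.1.2 y.2).trans
    (PartialLift.app_congr rfl (SSet.stdSimplex.objEquiv.injective (Category.id_comp _)) y.1.2 _)

lemma classify_universalPartialLift {K : SSet.{0}} (φ : K ⟶ partialLifts p b) :
    (universalPartialLift φ).classify = φ := by
  ext n s
  exact universalPartialLift_precomp φ s

lemma PartialLift.exists_extension (hp : ∀ d, I.rlp (p.app d)) {n : ℕ}
    (t : PartialLift p b (∂Δ[n] : SSet.{0})) (τ : Δ[n] ⟶ nerve D)
    (ht : t.map = (∂Δ[n] : SSet.Subcomplex _).ι ≫ τ) :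
    ∃ t' : PartialLift p b Δ[n], t'.map = τ ∧ t'.precomp (∂Δ[n] : SSet.Subcomplex _).ι = t := by
  obtain ⟨_, l, hl⟩ := t
  subst ht
  have := hasLiftingProperty_overPullbackMap_boundary hp τ
  have sq : CommSq l (overPullbackMap (∂Δ[n] : SSet.Subcomplex _).ι rfl) p
      (overPullbackProj τ ≫ b) := ⟨hl⟩
  exact ⟨⟨τ, sq.lift, sq.fac_right⟩, rfl, ext_of_overPullbackMap rfl sq.fac_left⟩

lemma rlp_I_partialLiftsProj (hp : ∀ d, I.rlp (p.app d)) : I.rlp (partialLiftsProj p b) := by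
  rintro _ _ _ ⟨n⟩
  refine ⟨fun {f τ} sq ↦ ?_⟩
  obtain ⟨t, rfl, ht⟩ := (universalPartialLift f).exists_extension hp τ sq.w
  exact ⟨⟨{
    l := t.classify
    fac_left := by rw [PartialLift.comp_classify, ht, classify_universalPartialLift]
    fac_right := t.classify_proj }⟩⟩

variable (D) in
lemma isCofibrantDiagram_overNerve : IsCofibrantDiagram (overNerve D) := by
  intro E B p hp b
  -- A lift of `b` is a section of `partialLifts p b ⟶ N(D)`, which is a trivial fibration because
  -- partial lifts extend over cells.
  have hr := rlp_I_partialLiftsProj (b := b) hp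
  rw [← SSet.rlp_monomorphisms] at hr
  have := hr (⊥ : (nerve D).Subcomplex).ι inferInstance
  have sq : CommSq (SSet.Subcomplex.isInitialBot.to (partialLifts p b))
      (⊥ : (nerve D).Subcomplex).ι (partialLiftsProj p b) (𝟙 (nerve D)) :=
    ⟨SSet.Subcomplex.isInitialBot.hom_ext _ _⟩
  obtain ⟨t, ht⟩ : ∃ t : PartialLift p b (nerve D), t.map = 𝟙 _ :=
    ⟨universalPartialLift sq.lift, sq.fac_right⟩
  obtain ⟨_, l, hl⟩ := t
  subst ht
  let diag : overNerve D ⟶ overPullback (𝟙 (nerve D)) :=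
    { app d := { app m := ↾fun x ↦
        ⟨((nerveMap (CostructuredArrow.proj (𝟭 D) d)).app m x, x), rfl⟩ } }
  exact ⟨diag ≫ l, congrArg (diag ≫ ·) hl⟩

end PartialLifts

/-! ### Homotopy of maps into a Kan complex -/

lemma nonempty_homotopy_iff {A X : SSet.{0}} (f g : A ⟶ X) :
    Nonempty (SSet.Homotopy f g) ↔ ∃ H : Δ[1] ⊗ A ⟶ X, HasEnds H f g := by
  constructor
  · rintro ⟨H⟩
    exact ⟨(β_ _ _).hom ≫ H.h, fun m a ↦ congrArg (fun φ : A ⟶ X ↦ φ.app m a) H.h₀,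
      fun m a ↦ congrArg (fun φ : A ⟶ X ↦ φ.app m a) H.h₁⟩
  · rintro ⟨H, h₀, h₁⟩
    exact ⟨
      { h := (β_ _ _).hom ≫ H
        h₀ := by
          ext m a
          exact h₀ m a
        h₁ := by
          ext m a
          exact h₁ m a
        rel := by
          ext m ⟨⟨x, hx⟩, _⟩
          exact hx.elim }⟩

lemma hasEnds_refl {A X : SSet.{0}} (f : A ⟶ X) :
    HasEnds (CartesianMonoidalCategory.snd _ _ ≫ f) f f :=
  ⟨fun _ _ ↦ rfl, fun _ _ ↦ rfl⟩

lemma mono_whiskerRight {A B : SSet.{0}} (i : A ⟶ B) [Mono i] (X : SSet.{0}) : Mono (i ▷ X) := by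
  have (m : SimplexCategoryᵒᵖ) : Mono ((i ▷ X).app m) := by
    rw [CategoryTheory.mono_iff_injective]
    rintro ⟨a, x⟩ ⟨b, y⟩ h
    exact Prod.ext ((CategoryTheory.mono_iff_injective (i.app m)).1 inferInstance
      (Prod.mk.inj h).1) (Prod.mk.inj h).2
  exact NatTrans.mono_of_mono_app _

lemma HasEnds.exists_of_common_source {A X : SSet.{0}} [SSet.KanComplex X] {f g h : A ⟶ X}
    {H H' : Δ[1] ⊗ A ⟶ X} (hH : HasEnds H f g) (hH' : HasEnds H' f h) :
    ∃ H'' : Δ[1] ⊗ A ⟶ X, HasEnds H'' g h := by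
  have := mono_whiskerRight (∂Δ[1] : Δ[1].Subcomplex).ι A
  obtain ⟨l, hl, -⟩ := exists_homotopy_extension (∂Δ[1].ι ▷ A)
    (CartesianMonoidalCategory.lift
      (CartesianMonoidalCategory.snd _ _ ≫ CartesianMonoidalCategory.fst _ _)
      (CartesianMonoidalCategory.lift (CartesianMonoidalCategory.fst _ _)
        (CartesianMonoidalCategory.snd _ _ ≫ CartesianMonoidalCategory.snd _ _)) ≫
      boundaryPair H H')
    (CartesianMonoidalCategory.snd _ _ ≫ f) (by
      ext m ⟨t, a⟩
      change (if SSet.stdSimplex.asOrderHom t.1 0 = 0 then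
        H.app m (SSet.stdSimplex.const 1 0 m, a) else
        H'.app m (SSet.stdSimplex.const 1 0 m, a)) = f.app m a
      rw [hH.1, hH'.1, ite_self])
  refine ⟨cylinderEnd (Δ[1] ⊗ A) 1 ≫ l, (hasEnds_iff _ _ _).2 ?_⟩
  ext m ⟨t, a⟩
  refine (congrArg (fun φ : Δ[1] ⊗ (∂Δ[1] : SSet.{0}) ⊗ A ⟶ X ↦
    φ.app m (SSet.stdSimplex.const 1 1 m, t, a)) hl).trans ?_
  change (if SSet.stdSimplex.asOrderHom t.1 0 = 0 then
      H.app m (SSet.stdSimplex.const 1 1 m, a) else H'.app m (SSet.stdSimplex.const 1 1 m, a)) =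
    if SSet.stdSimplex.asOrderHom t.1 0 = 0 then g.app m a else h.app m a
  rw [hH.2, hH'.2]

lemma homotopy_equivalence (A X : SSet.{0}) [SSet.KanComplex X] :
    Equivalence (fun f g : A ⟶ X ↦ Nonempty (SSet.Homotopy f g)) := by
  simp only [nonempty_homotopy_iff]
  have symm {f g : A ⟶ X} : (∃ H, HasEnds H f g) → ∃ H, HasEnds H g f :=
    fun ⟨_, hH⟩ ↦ hH.exists_of_common_source (hasEnds_refl f)
  refine ⟨fun f ↦ ⟨_, hasEnds_refl f⟩, symm, fun h ⟨_, h'⟩ ↦ ?_⟩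
  obtain ⟨_, h⟩ := symm h
  exact h.exists_of_common_source h'

/-! ### Nerves and natural transformations -/

section Nerve

variable {C D E : Type} [SmallCategory C] [SmallCategory D] [SmallCategory E]

/-- The chain `0 ≤ ⋯ ≤ 0 ≤ 1 ≤ ⋯ ≤ 1` in `Fin 2` given by a simplex of `Δ[1]`. -/
def chainOfSimplex {m : SimplexCategoryᵒᵖ} (s : Δ[1].obj m) :
    ComposableArrows (Fin 2) m.unop.len :=
  (SSet.stdSimplex.asOrderHom s).monotone.functor

lemma nonempty_homotopy_of_natTrans {F G : C ⥤ D} (α : F ⟶ G) :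
    Nonempty (SSet.Homotopy (nerveMap F) (nerveMap G)) := by
  refine (nonempty_homotopy_iff _ _).2
    ⟨{ app m := ↾fun x ↦ (chainOfSimplex x.1).prod' x.2 ⋙
         Functor.uncurry.obj (ComposableArrows.mk₁ α)
       naturality m m' η := rfl }, fun m x ↦ ?_, fun m x ↦ ?_⟩
  · refine CategoryTheory.Functor.ext (fun i ↦ rfl) fun i j f ↦ ?_
    change ((ComposableArrows.mk₁ α).map (𝟙 0)).app (x.obj i) ≫ F.map (x.map f) =
      𝟙 _ ≫ F.map (x.map f) ≫ 𝟙 _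
    rw [(ComposableArrows.mk₁ α).map_id]
    exact (congrArg (𝟙 _ ≫ ·) (Category.comp_id _)).symm
  · refine CategoryTheory.Functor.ext (fun i ↦ rfl) fun i j f ↦ ?_
    change ((ComposableArrows.mk₁ α).map (𝟙 1)).app (x.obj i) ≫ G.map (x.map f) =
      𝟙 _ ≫ G.map (x.map f) ≫ 𝟙 _
    rw [(ComposableArrows.mk₁ α).map_id]
    exact (congrArg (𝟙 _ ≫ ·) (Category.comp_id _)).symm

/-- Two functors are nerve homotopic if their nerves become homotopic in every Kan complex to which
the nerve of the target maps. As the nerve of the target need not be a Kan complex itself, homotopy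
of maps to it would not be an equivalence relation. -/
def NerveHomotopic (F G : C ⥤ D) : Prop :=
  ∀ (K : SSet.{0}) [SSet.KanComplex K] (k : nerve D ⟶ K),
    Nonempty (SSet.Homotopy (nerveMap F ≫ k) (nerveMap G ≫ k))

lemma nerveHomotopic_of_natTrans {F G : C ⥤ D} (α : F ⟶ G) : NerveHomotopic F G := by
  intro K _ k
  obtain ⟨H, hH⟩ := (nonempty_homotopy_iff _ _).1 (nonempty_homotopy_of_natTrans α)
  exact (nonempty_homotopy_iff _ _).2 ⟨H ≫ k, fun m a ↦ congrArg (k.app m) (hH.1 m a),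
    fun m a ↦ congrArg (k.app m) (hH.2 m a)⟩

lemma NerveHomotopic.symm {F G : C ⥤ D} (h : NerveHomotopic F G) : NerveHomotopic G F :=
  fun K _ k ↦ (homotopy_equivalence _ K).symm (h K k)

lemma NerveHomotopic.trans {F G H : C ⥤ D} (h : NerveHomotopic F G) (h' : NerveHomotopic G H) :
    NerveHomotopic F H :=
  fun K _ k ↦ (homotopy_equivalence _ K).trans (h K k) (h' K k)

lemma NerveHomotopic.comp_right {F G : C ⥤ D} (h : NerveHomotopic F G) (H : D ⥤ E) :
    NerveHomotopic (F ⋙ H) (G ⋙ H) :=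
  fun K _ k ↦ h K (nerveMap H ≫ k)

lemma NerveHomotopic.comp_left {F G : C ⥤ D} (h : NerveHomotopic F G) (H : E ⥤ C) :
    NerveHomotopic (H ⋙ F) (H ⋙ G) := by
  intro K _ k
  obtain ⟨T, hT⟩ := (nonempty_homotopy_iff _ _).1 (h K k)
  exact (nonempty_homotopy_iff _ _).2 ⟨Δ[1] ◁ nerveMap H ≫ T,
    fun m a ↦ hT.1 m ((nerveMap H).app m a), fun m a ↦ hT.2 m ((nerveMap H).app m a)⟩

lemma isContractible_nerve {d : D} (h : NerveHomotopic (𝟭 D) ((Functor.const D).obj d)) :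
    IsContractible (nerve D) := by
  let v : (nerve D) _⦋0⦌ := ComposableArrows.mk₀ d
  refine isContractible_of_nullHomotopic v fun K _ g ↦ ⟨g.app _ v, ?_⟩
  have hconst : nerveMap ((Functor.const D).obj d) = SSet.const v := by
    ext m x
    refine CategoryTheory.Functor.ext (fun i ↦ rfl) fun i j f ↦ ?_
    exact ((Category.id_comp _).trans (Category.id_comp _)).symm
  rw [← SSet.const_comp, ← hconst]
  exact h.symm K g

lemma isContractible_nerve_of_isTerminal {d : D} (hd : IsTerminal d) :
    IsContractible (nerve D) :=
  isContractible_nerve (nerveHomotopic_of_natTrans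
    { app X := hd.from X, naturality _ _ _ := hd.hom_ext _ _ } (G := (Functor.const D).obj d))

lemma isContractible_nerve_of_retract (Φ : C ⥤ D) (Ψ : D ⥤ C) (α : Φ ⋙ Ψ ⟶ 𝟭 C) {d : D}
    (h : NerveHomotopic (𝟭 D) ((Functor.const D).obj d)) : IsContractible (nerve C) :=
  isContractible_nerve (d := Ψ.obj d)
    (((nerveHomotopic_of_natTrans α).symm.trans ((h.comp_left Φ).comp_right Ψ)).trans
      (nerveHomotopic_of_natTrans { app _ := 𝟙 (Ψ.obj d) }))

end Nerve

/-! ### The diagram of nerves of left fibers -/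

section CostructuredNerve

variable {C D : Type} [SmallCategory C] [SmallCategory D] (F : D ⥤ C)

/-- The diagram of simplicial sets `c ↦ N(F/c)`. It is the left Kan extension along `F` of the
diagram `overNerve D`, see `costructuredNerveHomEquiv`. -/
def costructuredNerve : C ⥤ SSet.{0} where
  obj c := nerve (CostructuredArrow F c)
  map g := nerveMap (CostructuredArrow.map g)
  map_id c := by
    ext m x
    refine costructuredArrow_chain_ext rfl fun i ↦ ?_
    refine ((congrArg (· ≫ _) (F.map_id _)).trans (Category.id_comp _)).trans ?_
    exact (Category.comp_id _).symm
  map_comp f g := by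
    ext m x
    refine costructuredArrow_chain_ext rfl fun i ↦ ?_
    refine ((congrArg (· ≫ _) (F.map_id _)).trans (Category.id_comp _)).trans ?_
    exact Category.assoc _ _ _

/-- The maps `N(D/d) ⟶ N(F/F(d))`. -/
def costructuredNerveUnit : overNerve D ⟶ F ⋙ costructuredNerve F where
  app d := nerveMap (CostructuredArrow.post (𝟭 D) F d)
  naturality d e g := by
    ext m x
    refine costructuredArrow_chain_ext rfl fun i ↦ ?_
    refine ((congrArg (· ≫ _) (F.map_id _)).trans (Category.id_comp _)).trans ?_
    exact (F.map_comp _ _).symm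

/-- The maps `N(F/c) ⟶ N(C/c)`. -/
def costructuredNerveToOver : costructuredNerve F ⟶ overNerve C where
  app c := nerveMap (CostructuredArrow.toOver F c)
  naturality d e g := by
    ext m x
    refine costructuredArrow_chain_ext (F := 𝟭 C) rfl fun i ↦ ?_
    exact Category.id_comp (obj := C) _

lemma costructuredNerveUnit_toOver :
    costructuredNerveUnit F ≫ Functor.whiskerLeft F (costructuredNerveToOver F) =
      overNerveMap F := by
  ext d m x
  refine costructuredArrow_chain_ext (F := 𝟭 C) rfl fun i ↦ ?_
  exact Category.id_comp (obj := C) _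

lemma costructuredNerveUnit_chainOver {m : SimplexCategoryᵒᵖ} (σ : (nerve D).obj m) :
    ((costructuredNerveUnit F).app _).app m (chainOver (𝟭 D) σ (𝟙 _)) = chainOver F σ (𝟙 _) := by
  refine costructuredArrow_chain_ext rfl fun i ↦ ?_
  refine ((congrArg (· ≫ _) (F.map_id _)).trans (Category.id_comp _)).trans ?_
  exact ((F.map_comp _ _).trans (congrArg (_ ≫ ·) (F.map_id _))).symm

variable {F}

lemma map_chainOver_id {c : C} {m : SimplexCategoryᵒᵖ}
    (y : (nerve (CostructuredArrow F c)).obj m) :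
    ((costructuredNerve F).map (y.obj (Fin.last _)).hom).app m
      (chainOver F ((nerveMap (CostructuredArrow.proj F c)).app m y) (𝟙 _)) = y := by
  refine (nerveMap_map_chainOver _ _ _).trans ?_
  exact (congrArg (chainOver F _) (Category.id_comp _)).trans (chainOver_proj y)

variable {X : C ⥤ SSet.{0}}

lemma app_eq_map_chainOver {X : D ⥤ SSet.{0}} (φ : overNerve D ⟶ X) {d : D}
    {m : SimplexCategoryᵒᵖ} (x : (nerve (Over d)).obj m) :
    (φ.app d).app m x = (X.map (x.obj (Fin.last _)).hom).app m ((φ.app _).app m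
      (chainOver (𝟭 D) ((nerveMap (CostructuredArrow.proj (𝟭 D) d)).app m x) (𝟙 _))) :=
  (congrArg ((φ.app d).app m) (map_chainOver_id (F := 𝟭 D) x).symm).trans
    (ConcreteCategory.congr_hom (congr_app (φ.naturality (x.obj (Fin.last _)).hom) m) _)

/-- The extension to `c ↦ N(F/c)` of a map of diagrams defined on `d ↦ N(D/d)`. -/
def costructuredNerveDesc (φ : overNerve D ⟶ F ⋙ X) : costructuredNerve F ⟶ X where
  app c :=
    { app m := ↾fun y ↦ (X.map (y.obj (Fin.last _)).hom).app m ((φ.app _).app m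
        (chainOver (𝟭 D) ((nerveMap (CostructuredArrow.proj F c)).app m y) (𝟙 _)))
      naturality m m' η := by
        ext y
        let ρ : (nerve D).obj m := (nerveMap (CostructuredArrow.proj F c)).app m y
        let w := ρ.map (homOfLE (Fin.le_last (η.unop.toOrderHom (Fin.last _))))
        have hw : (y.obj (η.unop.toOrderHom (Fin.last _))).hom =
            F.map (w ≫ 𝟙 _) ≫ (y.obj (Fin.last _)).hom :=
          (CostructuredArrow.w (y.map (homOfLE (Fin.le_last _)))).symm.trans
            (congrArg (F.map · ≫ _) (Category.comp_id w).symm)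
        refine (congrArg (fun g ↦ (X.map g).app m' _) hw).trans ?_
        refine (ConcreteCategory.congr_hom (congr_app (X.map_comp _ _) m') _).trans ?_
        refine Eq.trans ?_ (NatTrans.naturality_apply (X.map (y.obj (Fin.last _)).hom) η _)
        refine congrArg ((X.map (y.obj (Fin.last _)).hom).app m') ?_
        exact (app_eq_map_chainOver φ ((nerve (Over _)).map η (chainOver (𝟭 D) ρ (𝟙 _)))).symm.trans
          (NatTrans.naturality_apply (φ.app _) η (chainOver (𝟭 D) ρ (𝟙 _))) }
  naturality c c' g := by
    ext m y
    exact ConcreteCategory.congr_hom (congr_app (X.map_comp (y.obj (Fin.last _)).hom g) m) _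

/-- Maps out of `c ↦ N(F/c)` correspond to maps out of `d ↦ N(D/d)`. -/
def costructuredNerveHomEquiv : (costructuredNerve F ⟶ X) ≃ (overNerve D ⟶ F ⋙ X) where
  toFun ψ := costructuredNerveUnit F ≫ Functor.whiskerLeft F ψ
  invFun φ := costructuredNerveDesc φ
  left_inv ψ := by
    ext c m y
    refine (ConcreteCategory.congr_hom
      (congr_app (ψ.naturality (y.obj (Fin.last _)).hom) m) _).symm.trans ?_
    exact congrArg ((ψ.app c).app m) ((congrArg _ (costructuredNerveUnit_chainOver F _)).trans
      (map_chainOver_id y))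
  right_inv φ := by
    ext d m x
    exact (app_eq_map_chainOver φ x).symm

lemma isCofibrantDiagram_costructuredNerve (F : D ⥤ C) :
    IsCofibrantDiagram (costructuredNerve F) := by
  intro E B p hp b
  obtain ⟨l, hl⟩ := isCofibrantDiagram_overNerve D (Functor.whiskerLeft F p)
    (fun d ↦ hp (F.obj d)) (costructuredNerveHomEquiv b)
  obtain ⟨l, rfl⟩ := costructuredNerveHomEquiv.surjective l
  exact ⟨l, costructuredNerveHomEquiv.injective hl⟩

lemma diagramHomotopic_iff_exists_preDiagram {A : C ⥤ SSet.{0}} {f g : A ⟶ X} :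
    DiagramHomotopic f g ↔ ∃ H : A ⟶ X ⋙ ihom Δ[1],
      H ≫ preDiagram ∂Δ[1].ι X = curryDiagram (boundaryPairDiagram f g) := by
  constructor
  · rintro ⟨H, hH⟩
    refine ⟨curryDiagram H, ?_⟩
    ext1
    ext1 c
    exact (MonoidalClosed.curry_pre_app _ _).trans
      (congrArg MonoidalClosed.curry ((hasEnds_iff _ _ _).1 (hH c)))
  · rintro ⟨H, hH⟩
    exact ⟨uncurryDiagram H, fun c ↦
      (hasEnds_iff _ _ _).2 (uncurryDiagram_comp_preDiagram ∂Δ[1].ι hH c)⟩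

lemma DiagramHomotopic.whiskerLeft {A : C ⥤ SSet.{0}} {f g : A ⟶ X} (h : DiagramHomotopic f g)
    (F : D ⥤ C) : DiagramHomotopic (Functor.whiskerLeft F f) (Functor.whiskerLeft F g) := by
  obtain ⟨H, hH⟩ := h
  exact ⟨Functor.whiskerLeft F H, fun d ↦ hH (F.obj d)⟩

lemma diagramHomotopic_costructuredNerveHomEquiv_iff {f g : costructuredNerve F ⟶ X} :
    DiagramHomotopic (costructuredNerveHomEquiv f) (costructuredNerveHomEquiv g) ↔
      DiagramHomotopic f g := by
  refine ⟨fun h ↦ ?_, fun h ↦ (h.whiskerLeft F).precomp _⟩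
  obtain ⟨H, hH⟩ := diagramHomotopic_iff_exists_preDiagram.1 h
  obtain ⟨H, rfl⟩ := costructuredNerveHomEquiv (X := X ⋙ ihom Δ[1]).surjective H
  refine diagramHomotopic_iff_exists_preDiagram.2 ⟨H, costructuredNerveHomEquiv.injective ?_⟩
  refine Eq.trans hH ?_
  ext1
  ext1 d
  exact MonoidalClosed.curry_natural_left ((costructuredNerveUnit F).app d)
    (boundaryPair (f.app (F.obj d)) (g.app (F.obj d)))

end CostructuredNerve

/-! ### Restriction of homotopy classes along a left cofinal functor -/

section HomotopyClasses

variable {C D : Type} [SmallCategory C] [SmallCategory D]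

/-- The set `[A, X]` of maps of diagrams modulo the equivalence relation generated by homotopy. -/
def HomotopyClasses (A X : C ⥤ SSet.{0}) : Type :=
  Quot (DiagramHomotopic (A := A) (X := X))

namespace HomotopyClasses

variable {A B B' X : C ⥤ SSet.{0}}

/-- The map `[B, X] ⟶ [A, X]` given by composition with a map `A ⟶ B`. -/
def precomp (f : A ⟶ B) (X : C ⥤ SSet.{0}) : HomotopyClasses B X → HomotopyClasses A X :=
  Quot.map (f ≫ ·) fun _ _ h ↦ h.precomp f

lemma precomp_comp (f : A ⟶ B) (g : B ⟶ B') : precomp (f ≫ g) X = precomp f X ∘ precomp g X := by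
  ext ⟨ψ⟩
  exact congrArg (Quot.mk _) (Category.assoc f g ψ)

lemma precomp_eq_of_diagramHomotopic {f g : A ⟶ B} (h : DiagramHomotopic f g) :
    precomp f X = precomp g X := by
  ext ⟨ψ⟩
  exact Quot.sound (h.postcomp ψ)

/-- The map `[overNerve C, X] ⟶ [overNerve D, F ⋙ X]` given by restriction along `F`. -/
def restrict (F : D ⥤ C) (X : C ⥤ SSet.{0}) :
    HomotopyClasses (overNerve C) X → HomotopyClasses (overNerve D) (F ⋙ X) :=
  Quot.map (fun ψ ↦ overNerveMap F ≫ Functor.whiskerLeft F ψ) fun _ _ h ↦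
    (h.whiskerLeft F).precomp _

end HomotopyClasses

lemma diagramHomotopic_refl {A X : C ⥤ SSet.{0}} (f : A ⟶ X) : DiagramHomotopic f f :=
  ⟨{ app c := CartesianMonoidalCategory.snd _ _ ≫ f.app c
     naturality c d g := by
       ext m ⟨_, a⟩
       exact ConcreteCategory.congr_hom (congr_app (f.naturality g) m) a },
    fun c ↦ hasEnds_refl (f.app c)⟩

lemma IsDiagramAnodyne.bijective_precomp {A B X : C ⥤ SSet.{0}} {j : A ⟶ B}
    (hj : IsDiagramAnodyne j) (hX : ∀ c, SSet.KanComplex (X.obj c)) :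
    Function.Bijective (HomotopyClasses.precomp j X) := by
  choose E hE using fun f : A ⟶ X ↦ hj.exists_extension hX f
  let e : HomotopyClasses A X → HomotopyClasses B X :=
    Quot.map E fun f g h ↦ hj.diagramHomotopic_of_precomp hX (by rwa [hE, hE])
  refine Function.bijective_iff_has_inverse.2 ⟨e, ?_, ?_⟩
  · rintro ⟨ψ⟩
    refine Quot.sound (hj.diagramHomotopic_of_precomp hX ?_)
    rw [hE]
    exact diagramHomotopic_refl _
  · rintro ⟨f⟩
    exact congrArg (Quot.mk _) (hE f)

lemma exists_isDiagramAnodyne_to_isAcyclicKan {W : C ⥤ SSet.{0}}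
    (hW : ∀ c, IsContractible (W.obj c)) :
    ∃ (Z : C ⥤ SSet.{0}) (j : W ⟶ Z), IsDiagramAnodyne j ∧ (∀ c, SSet.KanComplex (Z.obj c)) ∧
      ∀ c, IsAcyclicKan (Z.obj c) := by
  obtain ⟨Z, j, hj, hZ⟩ := exists_isDiagramAnodyne_to_kanComplex W
  refine ⟨Z, j, hj, hZ, fun c ↦ ?_⟩
  have := hZ c
  exact (hW c).isAcyclicKan (hj.app c)

lemma bijective_precomp_of_isContractible {A B X : C ⥤ SSet.{0}} (f : A ⟶ B)
    (hA : IsCofibrantDiagram A) (hB : IsCofibrantDiagram B)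
    (hA' : ∀ c, IsContractible (A.obj c)) (hB' : ∀ c, IsContractible (B.obj c))
    (hX : ∀ c, SSet.KanComplex (X.obj c)) :
    Function.Bijective (HomotopyClasses.precomp f X) := by
  obtain ⟨Z, j, hj, -, hZ⟩ := exists_isDiagramAnodyne_to_isAcyclicKan hA'
  obtain ⟨V, k, hk, hV, hV'⟩ := exists_isDiagramAnodyne_to_isAcyclicKan hB'
  obtain ⟨s⟩ := hB.nonempty_hom hZ
  obtain ⟨r, -⟩ := hj.exists_extension hV (f ≫ k)
  have hfs : HomotopyClasses.precomp f X ∘ HomotopyClasses.precomp s X =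
      HomotopyClasses.precomp j X := by
    rw [← HomotopyClasses.precomp_comp]
    exact HomotopyClasses.precomp_eq_of_diagramHomotopic (hA.diagramHomotopic hZ _ _)
  have hsr : HomotopyClasses.precomp s X ∘ HomotopyClasses.precomp r X =
      HomotopyClasses.precomp k X := by
    rw [← HomotopyClasses.precomp_comp]
    exact HomotopyClasses.precomp_eq_of_diagramHomotopic (hB.diagramHomotopic hV' _ _)
  have hs : Function.Bijective (HomotopyClasses.precomp s X) :=
    ⟨.of_comp (hfs ▸ (hj.bijective_precomp hX).1), .of_comp (hsr ▸ (hk.bijective_precomp hX).2)⟩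
  exact (Function.Bijective.of_comp_iff _ hs).1 (hfs ▸ hj.bijective_precomp hX)

variable (C) in
lemma isContractible_overNerve (c : C) : IsContractible ((overNerve C).obj c) :=
  isContractible_nerve_of_isTerminal (D := Over c) Over.mkIdTerminal

lemma IsLeftCofinal.bijective_restrict {F : D ⥤ C} (hF : IsLeftCofinal F) {X : C ⥤ SSet.{0}}
    (hX : ∀ c, SSet.KanComplex (X.obj c)) :
    Function.Bijective (HomotopyClasses.restrict F X) := by
  let e : HomotopyClasses (costructuredNerve F) X ≃ HomotopyClasses (overNerve D) (F ⋙ X) :=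
    Quot.congr costructuredNerveHomEquiv fun _ _ ↦
      diagramHomotopic_costructuredNerveHomEquiv_iff.symm
  have he : HomotopyClasses.restrict F X =
      e ∘ HomotopyClasses.precomp (costructuredNerveToOver F) X := by
    ext ⟨ψ⟩
    exact congrArg (fun φ ↦ Quot.mk _ (φ ≫ Functor.whiskerLeft F ψ))
      (costructuredNerveUnit_toOver F).symm
  rw [he]
  exact e.bijective.comp (bijective_precomp_of_isContractible _
    (isCofibrantDiagram_costructuredNerve F) (isCofibrantDiagram_overNerve C) hF
    (isContractible_overNerve C) hX)

end HomotopyClasses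

/-! ### Loop spaces and homotopy limits as mapping spaces -/

/-- The nondegenerate top simplex of the standard simplex. -/
def idSimplex (m : SimplexCategoryᵒᵖ) : (SSet.stdSimplex.obj m.unop : SSet.{0}).obj m :=
  SSet.stdSimplex.objEquiv.symm (𝟙 m.unop)

lemma yonedaEquiv_symm_app_idSimplex {A : SSet.{0}} {m : SimplexCategoryᵒᵖ} (a : A.obj m) :
    (SSet.yonedaEquiv.symm a : SSet.stdSimplex.obj m.unop ⟶ A).app m (idSimplex m) = a :=
  SSet.yonedaEquiv.apply_symm_apply a

lemma stdSimplex_map_app_idSimplex {m l : SimplexCategoryᵒᵖ} (η : m ⟶ l) :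
    (SSet.stdSimplex.map η.unop : SSet.stdSimplex.obj l.unop ⟶ SSet.stdSimplex.obj m.unop).app l
      (idSimplex l) = (SSet.stdSimplex.obj m.unop : SSet.{0}).map η (idSimplex m) := by
  apply SSet.stdSimplex.objEquiv.injective
  exact (Category.id_comp η.unop).trans (Category.comp_id η.unop).symm

lemma exists_map_idSimplex {m l : SimplexCategoryᵒᵖ}
    (s : (SSet.stdSimplex.obj m.unop : SSet.{0}).obj l) :
    ∃ η : m ⟶ l, s = (SSet.stdSimplex.obj m.unop : SSet.{0}).map η (idSimplex m) :=
  ⟨(SSet.stdSimplex.objEquiv s).op, SSet.stdSimplex.objEquiv.injective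
    (Category.comp_id (SSet.stdSimplex.objEquiv s)).symm⟩

lemma yonedaEquiv_symm_app {A : SSet.{0}} {m l : SimplexCategoryᵒᵖ} (a : A.obj m) (η : m ⟶ l) :
    (SSet.yonedaEquiv.symm a : SSet.stdSimplex.obj m.unop ⟶ A).app l
      ((SSet.stdSimplex.obj m.unop : SSet.{0}).map η (idSimplex m)) = A.map η a := by
  rw [NatTrans.naturality_apply, yonedaEquiv_symm_app_idSimplex]

lemma tensor_naturality {A B X : SSet.{0}} (φ : A ⊗ B ⟶ X) {m l : SimplexCategoryᵒᵖ} (η : m ⟶ l)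
    (a : A.obj m) (b : B.obj m) :
    φ.app l (A.map η a, B.map η b) = X.map η (φ.app m (a, b)) :=
  NatTrans.naturality_apply φ η ((a, b) : (A ⊗ B).obj m)

section Loop

variable {A : SSet.{0}} {B : PSSet}

/-- The map into the loop object adjoint to a map `A × Δ[1] ⟶ B`. -/
def toLoop (h : A ⊗ Δ[1] ⟶ B.X) (h₀ : SSet.ι₀ ≫ h = SSet.const B.pt)
    (h₁ : SSet.ι₁ ≫ h = SSet.const B.pt) : A ⟶ B.loopSSet where
  app n := ↾fun a ↦ ⟨(SSet.yonedaEquiv.symm a ▷ Δ[1]) ≫ h, by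
    rw [SSet.ι₀_comp_assoc, SSet.ι₁_comp_assoc, h₀, h₁]
    exact ⟨rfl, rfl⟩⟩
  naturality n m θ := by
    ext a
    apply Subtype.ext
    change (SSet.yonedaEquiv.symm (A.map θ a) ▷ Δ[1]) ≫ h =
      (SSet.stdSimplex.map θ.unop ▷ Δ[1]) ≫ (SSet.yonedaEquiv.symm a ▷ Δ[1]) ≫ h
    rw [← Category.assoc, ← comp_whiskerRight, map_comp_yonedaEquiv_symm]

/-- The map `A × Δ[1] ⟶ B` adjoint to a map into the loop object. -/
def ofLoop (f : A ⟶ B.loopSSet) : A ⊗ Δ[1] ⟶ B.X where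
  app m := ↾fun x ↦ (f.app m x.1).1.app m (idSimplex m, x.2)
  naturality m l η := by
    ext x
    change (f.app l (A.map η x.1)).1.app l (idSimplex l, Δ[1].map η x.2) = _
    rw [NatTrans.naturality_apply]
    refine Eq.trans ?_ (tensor_naturality (f.app m x.1).1 η (idSimplex m) x.2)
    exact congrArg (fun s ↦ (f.app m x.1).1.app l (s, Δ[1].map η x.2))
      (stdSimplex_map_app_idSimplex η)

lemma ofLoop_toLoop (h : A ⊗ Δ[1] ⟶ B.X) (h₀ : SSet.ι₀ ≫ h = SSet.const B.pt)
    (h₁ : SSet.ι₁ ≫ h = SSet.const B.pt) : ofLoop (toLoop h h₀ h₁) = h := by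
  ext m x
  exact congrArg (fun a ↦ h.app m (a, x.2)) (yonedaEquiv_symm_app_idSimplex x.1)

lemma ι₀_ofLoop (f : A ⟶ B.loopSSet) : SSet.ι₀ ≫ ofLoop f = SSet.const B.pt := by
  ext m a
  exact congrArg (fun φ : SSet.stdSimplex.obj m.unop ⟶ B.X ↦ φ.app m (idSimplex m))
    (f.app m a).2.1

lemma ι₁_ofLoop (f : A ⟶ B.loopSSet) : SSet.ι₁ ≫ ofLoop f = SSet.const B.pt := by
  ext m a
  exact congrArg (fun φ : SSet.stdSimplex.obj m.unop ⟶ B.X ↦ φ.app m (idSimplex m))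
    (f.app m a).2.2

lemma toLoop_ofLoop (f : A ⟶ B.loopSSet) : toLoop (ofLoop f) (ι₀_ofLoop f) (ι₁_ofLoop f) = f := by
  ext m a
  apply Subtype.ext
  ext l ⟨s, t⟩
  obtain ⟨η, rfl⟩ := exists_map_idSimplex s
  refine (congrArg (fun b ↦ (f.app l b).1.app l (idSimplex l, t))
    (yonedaEquiv_symm_app a η)).trans ?_
  rw [NatTrans.naturality_apply]
  exact congrArg (fun s ↦ (f.app m a).1.app l (s, t)) (stdSimplex_map_app_idSimplex η)

lemma ofLoop_injective {f g : A ⟶ B.loopSSet} (h : ofLoop f = ofLoop g) : f = g := by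
  rw [← toLoop_ofLoop f, ← toLoop_ofLoop g]
  congr 1

lemma ofLoop_comp {A' : SSet.{0}} (i : A' ⟶ A) (f : A ⟶ B.loopSSet) :
    ofLoop (i ≫ f) = i ▷ Δ[1] ≫ ofLoop f := rfl

lemma const_ofLoop_ends (k : Fin 2) (f : A ⟶ B.loopSSet) {m : SimplexCategoryᵒᵖ} (a : A.obj m) :
    (ofLoop f).app m (a, SSet.stdSimplex.const 1 k m) = (SSet.const B.pt : A ⟶ B.X).app m a := by
  obtain rfl | rfl : k = 0 ∨ k = 1 := by omega
  · exact congrArg (fun φ : A ⟶ B.X ↦ φ.app m a) (ι₀_ofLoop f)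
  · exact congrArg (fun φ : A ⟶ B.X ↦ φ.app m a) (ι₁_ofLoop f)

lemma kanComplex_loop [SSet.KanComplex B.X] : SSet.KanComplex B.loopSSet := by
  refine kanComplex_of_hornFilling fun n i σ₀ ↦ ?_
  have hr := rlp_I_pre_of_anodyneExtensions (Λ[n + 1, i] : Δ[n + 1].Subcomplex)
    (SSet.anodyneExtensions.horn_ι i) B.X
  obtain ⟨l, hl, hl'⟩ := exists_tensor_lift_sset Λ[n + 1, i].ι ∂Δ[1].ι
    (hr _ (boundary_ι_mem_I 1)) (SSet.const B.pt) (ofLoop σ₀) (by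
      ext m ⟨a, s⟩
      refine Eq.trans ?_ (congrArg (fun t ↦ (ofLoop σ₀).app m (a, t))
        (eq_const_of_boundary_one s)).symm
      exact (const_ofLoop_ends _ σ₀ a).symm)
  have l_ends (k : Fin 2) (m : SimplexCategoryᵒᵖ) (a : Δ[n + 1].obj m) :
      l.app m (a, SSet.stdSimplex.const 1 k m) = (SSet.const B.pt : Δ[n + 1] ⟶ B.X).app m a :=
    congrArg (fun φ : Δ[n + 1] ⊗ (∂Δ[1] : SSet.{0}) ⟶ B.X ↦
      φ.app m (a, ⟨_, const_mem_boundary_one k m⟩)) hl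
  refine ⟨toLoop l ?_ ?_, ofLoop_injective ?_⟩
  · ext m a
    exact l_ends 0 m a
  · ext m a
    exact l_ends 1 m a
  · rw [ofLoop_comp, ofLoop_toLoop, hl']

end Loop

section HolimMaps

variable {C D : Type} [SmallCategory C] [SmallCategory D] {A : SSet.{0}} {X : C ⥤ PSSet}

/-- The map into the homotopy limit given by a map of diagrams. -/
def toHolim (g : overNerve C ⋙ tensorLeft A ⟶ X ⋙ PSSet.forget) : A ⟶ (holimPSSet X).X where
  app m := ↾fun a ↦ Functor.whiskerLeft (overNerve C)
    ((tensoringLeft SSet.{0}).map (SSet.yonedaEquiv.symm a)) ≫ g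
  naturality m l η := by
    ext a
    refine NatTrans.ext (funext fun c ↦ ?_)
    change (SSet.yonedaEquiv.symm (A.map η a) ▷ (overNerve C).obj c) ≫ g.app c =
      (SSet.stdSimplex.map η.unop ▷ _) ≫ (SSet.yonedaEquiv.symm a ▷ _) ≫ g.app c
    rw [← Category.assoc, ← comp_whiskerRight, map_comp_yonedaEquiv_symm]

/-- The map of diagrams given by a map into the homotopy limit. -/
def ofHolim (f : A ⟶ (holimPSSet X).X) : overNerve C ⋙ tensorLeft A ⟶ X ⋙ PSSet.forget where
  app c :=
    { app m := ↾fun x ↦ (NatTrans.app (f.app m x.1) c).app m (idSimplex m, x.2)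
      naturality m l η := by
        ext x
        change (NatTrans.app (f.app l (A.map η x.1)) c).app l
          (idSimplex l, ((overNerve C).obj c).map η x.2) = _
        rw [NatTrans.naturality_apply]
        refine Eq.trans ?_ (tensor_naturality (NatTrans.app (f.app m x.1) c) η
          (idSimplex m) x.2)
        exact congrArg (fun s ↦ (NatTrans.app (f.app m x.1) c).app l
          (s, ((overNerve C).obj c).map η x.2)) (stdSimplex_map_app_idSimplex η) }
  naturality c d g := by
    ext m x
    exact congrArg (fun φ : (simplexOverNerve C m.unop).obj c ⟶ (X.obj d).X ↦
      φ.app m (idSimplex m, x.2)) (NatTrans.naturality (f.app m x.1) g)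

lemma ofHolim_toHolim (g : overNerve C ⋙ tensorLeft A ⟶ X ⋙ PSSet.forget) :
    ofHolim (toHolim g) = g := by
  ext c m x
  exact congrArg (fun a ↦ (g.app c).app m (a, x.2)) (yonedaEquiv_symm_app_idSimplex x.1)

lemma toHolim_ofHolim (f : A ⟶ (holimPSSet X).X) : toHolim (ofHolim f) = f := by
  ext m a
  refine NatTrans.ext (funext fun c ↦ ?_)
  ext l ⟨s, v⟩
  obtain ⟨η, rfl⟩ := exists_map_idSimplex s
  refine (congrArg (fun b ↦ (NatTrans.app (f.app l b) c).app l (idSimplex l, v))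
    (yonedaEquiv_symm_app a η)).trans ?_
  rw [NatTrans.naturality_apply]
  exact congrArg (fun s ↦ (NatTrans.app (f.app m a) c).app l (s, v))
    (stdSimplex_map_app_idSimplex η)

lemma ofHolim_injective {f g : A ⟶ (holimPSSet X).X} (h : ofHolim f = ofHolim g) : f = g := by
  rw [← toHolim_ofHolim f, ← toHolim_ofHolim g, h]

lemma kanComplex_holim (hX : ∀ c, SSet.KanComplex (X.obj c).X) :
    SSet.KanComplex (holimPSSet X).X := by
  refine kanComplex_of_hornFilling fun n i σ₀ ↦ ?_
  obtain ⟨l, hl⟩ := (isCofibrantDiagram_overNerve C).exists_tensor_lift Λ[n + 1, i].ι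
    (X ⋙ PSSet.forget) (fun c ↦ by
      have := hX c
      exact rlp_I_pre_of_anodyneExtensions (Λ[n + 1, i] : Δ[n + 1].Subcomplex)
        (SSet.anodyneExtensions.horn_ι i) (X.obj c).X) (ofHolim σ₀)
  refine ⟨toHolim l, ofHolim_injective ?_⟩
  refine NatTrans.ext (funext fun c ↦ ?_)
  refine Eq.trans ?_ (hl c)
  exact congrArg (Λ[n + 1, i].ι ▷ (overNerve C).obj c ≫ ·) (congr_app (ofHolim_toHolim l) c)

end HolimMaps

/-! ### Loops commute with homotopy limits -/

section HolimRestrict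

variable {C D : Type} [SmallCategory C] [SmallCategory D]

/-- The exchange of the last two factors. -/
abbrev swapLast (A B K : SSet.{0}) : (A ⊗ B) ⊗ K ⟶ (A ⊗ K) ⊗ B :=
  CartesianMonoidalCategory.lift
    (CartesianMonoidalCategory.lift
      (CartesianMonoidalCategory.fst _ _ ≫ CartesianMonoidalCategory.fst _ _)
      (CartesianMonoidalCategory.snd _ _))
    (CartesianMonoidalCategory.fst _ _ ≫ CartesianMonoidalCategory.snd _ _)

section

variable {A : SSet.{0}} {X : C ⥤ PSSet}

/-- A component of `loopHolimHom`. -/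
def loopHolimApp (φ : A ⊗ Δ[1] ⟶ (holimPSSet X).X)
    (h₀ : SSet.ι₀ ≫ φ = SSet.const (holimPSSet X).pt)
    (h₁ : SSet.ι₁ ≫ φ = SSet.const (holimPSSet X).pt) (c : C) :
    A ⊗ (overNerve C).obj c ⟶ (X.obj c).loopSSet :=
  toLoop (swapLast A ((overNerve C).obj c) Δ[1] ≫ (ofHolim φ).app c)
    (by
      ext m x
      exact congrArg (fun f : A ⟶ (holimPSSet X).X ↦
        (NatTrans.app (f.app m x.1) c).app m (idSimplex m, x.2)) h₀)
    (by
      ext m x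
      exact congrArg (fun f : A ⟶ (holimPSSet X).X ↦
        (NatTrans.app (f.app m x.1) c).app m (idSimplex m, x.2)) h₁)

lemma ofLoop_loopHolimApp (φ : A ⊗ Δ[1] ⟶ (holimPSSet X).X)
    (h₀ : SSet.ι₀ ≫ φ = SSet.const (holimPSSet X).pt)
    (h₁ : SSet.ι₁ ≫ φ = SSet.const (holimPSSet X).pt) (c : C) :
    ofLoop (loopHolimApp φ h₀ h₁ c) =
      swapLast A ((overNerve C).obj c) Δ[1] ≫ (ofHolim φ).app c :=
  ofLoop_toLoop _ _ _

/-- A family of loops in a homotopy limit, as a map into the homotopy limit of the loop objects. -/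
def loopHolimHom (φ : A ⊗ Δ[1] ⟶ (holimPSSet X).X)
    (h₀ : SSet.ι₀ ≫ φ = SSet.const (holimPSSet X).pt)
    (h₁ : SSet.ι₁ ≫ φ = SSet.const (holimPSSet X).pt) :
    overNerve C ⋙ tensorLeft A ⟶ (X ⋙ PSSet.loop) ⋙ PSSet.forget where
  app c := loopHolimApp φ h₀ h₁ c
  naturality c d g := by
    apply ofLoop_injective
    refine (congrArg ((A ◁ (overNerve C).map g) ▷ Δ[1] ≫ ·)
      (ofLoop_loopHolimApp φ h₀ h₁ d)).trans ?_
    refine Eq.trans ?_ (congrArg (· ≫ (X.map g).map) (ofLoop_loopHolimApp φ h₀ h₁ c)).symm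
    exact congrArg (swapLast A ((overNerve C).obj c) Δ[1] ≫ ·) ((ofHolim φ).naturality g)

/-- The map of diagrams adjoint to a map of diagrams into the loop objects. -/
def ofLoopDiagram (ψ : overNerve C ⋙ tensorLeft A ⟶ (X ⋙ PSSet.loop) ⋙ PSSet.forget) :
    overNerve C ⋙ tensorLeft (A ⊗ Δ[1]) ⟶ X ⋙ PSSet.forget where
  app c := swapLast A Δ[1] ((overNerve C).obj c) ≫ ofLoop (ψ.app c)
  naturality c d g :=
    congrArg (fun f : A ⊗ (overNerve C).obj c ⟶ (X.obj d).loopSSet ↦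
      swapLast A Δ[1] ((overNerve C).obj c) ≫ ofLoop f) (ψ.naturality g)

/-- The family of loops in the homotopy limit that is adjoint to a map into the homotopy limit of
the loop objects; it is inverse to `loopHolimHom`. -/
def loopHolimInv (ψ : overNerve C ⋙ tensorLeft A ⟶ (X ⋙ PSSet.loop) ⋙ PSSet.forget) :
    A ⊗ Δ[1] ⟶ (holimPSSet X).X :=
  toHolim (ofLoopDiagram ψ)

lemma ι₀_loopHolimInv (ψ : overNerve C ⋙ tensorLeft A ⟶ (X ⋙ PSSet.loop) ⋙ PSSet.forget) :
    SSet.ι₀ ≫ loopHolimInv ψ = SSet.const (holimPSSet X).pt := by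
  ext m a
  refine NatTrans.ext (funext fun c ↦ ?_)
  ext l ⟨s, v⟩
  exact const_ofLoop_ends 0 (ψ.app c) ((SSet.yonedaEquiv.symm a).app l s, v)

lemma ι₁_loopHolimInv (ψ : overNerve C ⋙ tensorLeft A ⟶ (X ⋙ PSSet.loop) ⋙ PSSet.forget) :
    SSet.ι₁ ≫ loopHolimInv ψ = SSet.const (holimPSSet X).pt := by
  ext m a
  refine NatTrans.ext (funext fun c ↦ ?_)
  ext l ⟨s, v⟩
  exact const_ofLoop_ends 1 (ψ.app c) ((SSet.yonedaEquiv.symm a).app l s, v)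

lemma loopHolimInv_hom (φ : A ⊗ Δ[1] ⟶ (holimPSSet X).X)
    (h₀ : SSet.ι₀ ≫ φ = SSet.const (holimPSSet X).pt)
    (h₁ : SSet.ι₁ ≫ φ = SSet.const (holimPSSet X).pt) :
    loopHolimInv (loopHolimHom φ h₀ h₁) = φ := by
  apply ofHolim_injective
  refine (ofHolim_toHolim _).trans (NatTrans.ext (funext fun c ↦ ?_))
  exact congrArg (swapLast A Δ[1] ((overNerve C).obj c) ≫ ·) (ofLoop_loopHolimApp φ h₀ h₁ c)

lemma loopHolimHom_inv (ψ : overNerve C ⋙ tensorLeft A ⟶ (X ⋙ PSSet.loop) ⋙ PSSet.forget) :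
    loopHolimHom (loopHolimInv ψ) (ι₀_loopHolimInv ψ) (ι₁_loopHolimInv ψ) = ψ := by
  refine NatTrans.ext (funext fun c ↦ ofLoop_injective ?_)
  refine (ofLoop_loopHolimApp (loopHolimInv ψ) (ι₀_loopHolimInv ψ) (ι₁_loopHolimInv ψ) c).trans ?_
  exact congrArg (swapLast A ((overNerve C).obj c) Δ[1] ≫ ·) (congr_app (ofHolim_toHolim _) c)

end

/-- Loops commute with homotopy limits. -/
def loopHolimIso (X : C ⥤ PSSet) :
    PSSet.loop.obj (holimPSSet X) ≅ holimPSSet (X ⋙ PSSet.loop) where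
  hom :=
    { map :=
        { app n := ↾fun φ ↦ loopHolimHom φ.1 φ.2.1 φ.2.2
          naturality n m θ := by
            ext φ
            refine NatTrans.ext (funext fun c ↦ ofLoop_injective ?_)
            have h := ((PSSet.loop.obj (holimPSSet X)).X.map θ φ).2
            refine (ofLoop_loopHolimApp _ h.1 h.2 c).trans ?_
            exact (congrArg ((SSet.stdSimplex.map θ.unop ▷ (overNerve C).obj c) ▷ Δ[1] ≫ ·)
              (ofLoop_loopHolimApp φ.1 φ.2.1 φ.2.2 c)).symm }
      map_pt := by
        refine NatTrans.ext (funext fun c ↦ ofLoop_injective ?_)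
        have h := (PSSet.loop.obj (holimPSSet X)).pt.2
        exact ofLoop_loopHolimApp _ h.1 h.2 c }
  inv :=
    { map :=
        { app n := ↾fun ψ ↦ ⟨loopHolimInv ψ, ι₀_loopHolimInv ψ, ι₁_loopHolimInv ψ⟩
          naturality n m θ := by
            ext ψ
            apply Subtype.ext
            apply ofHolim_injective
            refine (ofHolim_toHolim _).trans ?_
            refine NatTrans.ext (funext fun c ↦ ?_)
            exact (congrArg (fun ξ : overNerve C ⋙ tensorLeft (SSet.stdSimplex.obj n.unop ⊗ Δ[1]) ⟶
                X ⋙ PSSet.forget ↦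
              (SSet.stdSimplex.map θ.unop ▷ Δ[1]) ▷ (overNerve C).obj c ≫ ξ.app c)
              (ofHolim_toHolim (ofLoopDiagram ψ))).symm }
      map_pt := by
        apply Subtype.ext
        apply ofHolim_injective
        exact ofHolim_toHolim _ }
  hom_inv_id := by
    apply PSSet.hom_ext
    ext n φ
    exact Subtype.ext (loopHolimInv_hom φ.1 φ.2.1 φ.2.2)
  inv_hom_id := by
    apply PSSet.hom_ext
    ext n ψ
    exact loopHolimHom_inv ψ

/-! ### The restriction map on connected components -/

/-- The restriction map of homotopy limits of pointed simplicial sets. -/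
def holimPSSetRestrict (F : D ⥤ C) (X : C ⥤ PSSet) : holimPSSet X ⟶ holimPSSet (F ⋙ X) where
  map :=
    { app n := ↾fun α ↦
        Functor.whiskerRight (overNerveMap F) (tensorLeft (SSet.stdSimplex.obj n.unop)) ≫
          Functor.whiskerLeft F α
      naturality n m θ := by
        ext α
        rfl }
  map_pt := rfl

lemma loopHolimIso_restrict (F : D ⥤ C) (X : C ⥤ PSSet) :
    PSSet.loop.map (holimPSSetRestrict F X) ≫ (loopHolimIso (F ⋙ X)).hom =
      (loopHolimIso X).hom ≫ holimPSSetRestrict F (X ⋙ PSSet.loop) := by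
  apply PSSet.hom_ext
  ext n φ
  refine NatTrans.ext (funext fun c ↦ ofLoop_injective ?_)
  have h := ((PSSet.loop.map (holimPSSetRestrict F X)).map.app n φ).2
  refine (ofLoop_loopHolimApp _ h.1 h.2 c).trans ?_
  exact (congrArg ((SSet.stdSimplex.obj n.unop ◁ (overNerveMap F).app c) ▷ Δ[1] ≫ ·)
    (ofLoop_loopHolimApp φ.1 φ.2.1 φ.2.2 (F.obj c))).symm

section ConnectedComponents

variable {X : C ⥤ PSSet}

/-- A vertex of the homotopy limit is the same as a map of diagrams `overNerve C ⟶ X`. -/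
def holimVertexEquiv : (holimPSSet X).X _⦋0⦌ ≃ (overNerve C ⟶ X ⋙ PSSet.forget) where
  toFun α :=
    { app c :=
        { app m := ↾fun v ↦ (NatTrans.app α c).app m (SSet.stdSimplex.const 0 0 m, v)
          naturality m l η := by
            ext v
            exact tensor_naturality (NatTrans.app α c) η (SSet.stdSimplex.const 0 0 m) v }
      naturality c d g := by
        ext m v
        exact congrArg (fun φ : (simplexOverNerve C ⦋0⦌).obj c ⟶ (X.obj d).X ↦
          φ.app m (SSet.stdSimplex.const 0 0 m, v)) (NatTrans.naturality α g) }
  invFun ψ :=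
    { app c := CartesianMonoidalCategory.snd _ _ ≫ ψ.app c
      naturality c d g := by
        ext m ⟨_, a⟩
        exact ConcreteCategory.congr_hom (congr_app (ψ.naturality g) m) a :
      simplexOverNerve C ⦋0⦌ ⟶ X ⋙ PSSet.forget }
  left_inv α := by
    refine NatTrans.ext (funext fun c ↦ ?_)
    ext m ⟨s, v⟩
    refine congrArg (fun s ↦ (NatTrans.app α c).app m (s, v)) ?_
    apply SSet.stdSimplex.objEquiv.injective
    ext i : 3
    exact Subsingleton.elim (α := Fin 1) _ _
  right_inv _ := rfl

lemma holimVertexEquiv_δ_app (H : (holimPSSet X).X _⦋1⦌) (i : Fin 2) (c : C)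
    {m : SimplexCategoryᵒᵖ} (v : ((overNerve C).obj c).obj m) :
    ((holimVertexEquiv ((holimPSSet X).X.δ i H)).app c).app m v =
      (NatTrans.app H c).app m (SSet.stdSimplex.const 1 (i.succAbove 0) m, v) := by
  refine congrArg (fun s ↦ (NatTrans.app H c).app m (s, v)) ?_
  apply SSet.stdSimplex.objEquiv.injective
  ext k : 3
  rfl

lemma π₀Rel_holim_iff (α β : (holimPSSet X).X _⦋0⦌) :
    SSet.π₀Rel α β ↔ DiagramHomotopic (holimVertexEquiv α) (holimVertexEquiv β) := by
  constructor
  · rintro ⟨e⟩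
    obtain ⟨H, rfl, rfl⟩ : ∃ H, (holimPSSet X).X.δ 1 H = α ∧ (holimPSSet X).X.δ 0 H = β :=
      ⟨e.edge, e.src_eq, e.tgt_eq⟩
    exact ⟨H, fun c ↦ ⟨fun m v ↦ (holimVertexEquiv_δ_app H 1 c v).symm,
      fun m v ↦ (holimVertexEquiv_δ_app H 0 c v).symm⟩⟩
  · rintro ⟨H, hH⟩
    refine ⟨SSet.Edge.mk (H : simplexOverNerve C ⦋1⦌ ⟶ X ⋙ PSSet.forget)
      (holimVertexEquiv.injective ?_) (holimVertexEquiv.injective ?_)⟩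
    · ext c m v
      exact (holimVertexEquiv_δ_app _ 1 c v).trans ((hH c).1 m v)
    · ext c m v
      exact (holimVertexEquiv_δ_app _ 0 c v).trans ((hH c).2 m v)

unseal SSet.π₀ in
/-- The components of the homotopy limit are the homotopy classes of maps of diagrams
`overNerve C ⟶ X`. -/
def π₀HolimEquiv (X : C ⥤ PSSet) :
    SSet.π₀ (holimPSSet X).X ≃ HomotopyClasses (overNerve C) (X ⋙ PSSet.forget) :=
  Quot.congr holimVertexEquiv π₀Rel_holim_iff

unseal SSet.π₀ in
lemma π₀HolimEquiv_mapπ₀ (F : D ⥤ C) (x : SSet.π₀ (holimPSSet X).X) :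
    π₀HolimEquiv (F ⋙ X) (SSet.mapπ₀ (holimPSSetRestrict F X).map x) =
      HomotopyClasses.restrict F (X ⋙ PSSet.forget) (π₀HolimEquiv X x) := by
  obtain ⟨α, rfl⟩ := x.mk_surjective
  rfl

lemma IsLeftCofinal.bijective_mapπ₀ {F : D ⥤ C} (hF : IsLeftCofinal F)
    (hX : ∀ c, SSet.KanComplex (X.obj c).X) :
    Function.Bijective (SSet.mapπ₀ (holimPSSetRestrict F X).map) := by
  have h : SSet.mapπ₀ (holimPSSetRestrict F X).map = (π₀HolimEquiv (F ⋙ X)).symm ∘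
      HomotopyClasses.restrict F (X ⋙ PSSet.forget) ∘ π₀HolimEquiv X :=
    funext fun x ↦ (Equiv.eq_symm_apply _).2 (π₀HolimEquiv_mapπ₀ F x)
  rw [h]
  exact (Equiv.bijective _).comp ((hF.bijective_restrict hX).comp (Equiv.bijective _))

end ConnectedComponents

lemma IsLeftCofinal.isIso_loopIter {F : D ⥤ C} (hF : IsLeftCofinal F) (m : ℕ) :
    ∀ X : C ⥤ PSSet, (∀ c, SSet.KanComplex (X.obj c).X) →
      IsIso ((PSSet.loopIter m ⋙ PSSet.forget ⋙ SSet.π₀Functor).map (holimPSSetRestrict F X)) := by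
  induction m with
  | zero => exact fun X hX ↦ (isIso_iff_bijective _).2 (hF.bijective_mapπ₀ hX)
  | succ m ih =>
    intro X hX
    have h := ih (X ⋙ PSSet.loop) fun c ↦ by
      have := hX c
      exact kanComplex_loop (B := X.obj c)
    have h' : PSSet.loop.map (holimPSSetRestrict F X) = (loopHolimIso X).hom ≫
        holimPSSetRestrict F (X ⋙ PSSet.loop) ≫ (loopHolimIso (F ⋙ X)).inv := by
      rw [← Category.assoc, ← loopHolimIso_restrict, Category.assoc, Iso.hom_inv_id,
        Category.comp_id]
    change IsIso ((PSSet.loopIter m ⋙ PSSet.forget ⋙ SSet.π₀Functor).map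
      (PSSet.loop.map (holimPSSetRestrict F X)))
    rw [h', Functor.map_comp, Functor.map_comp]
    infer_instance

lemma weakEquiv_id (A : SSet.{0}) : WeakEquiv (𝟙 A) := fun K _ ↦
  ⟨fun g ↦ ⟨g, by
    rw [Category.id_comp]
    exact (homotopy_equivalence A K).refl g⟩, fun h h' H ↦ by
    rwa [Category.id_comp, Category.id_comp] at H⟩

lemma IsLeftCofinal.isStableEquiv_holimRestrict {F : D ⥤ C} (hF : IsLeftCofinal F)
    (Y : C ⥤ Spectrum) (hY : ∀ c, (Y.obj c).IsLevelKan) :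
    Spectrum.IsStableEquiv (holimRestrict F Y) := by
  refine ⟨holim Y, holim (F ⋙ Y), 𝟙 _, 𝟙 _, holimRestrict F Y, ?_, fun k ↦ weakEquiv_id _,
    fun k ↦ weakEquiv_id _, fun k ↦ kanComplex_holim fun c ↦ hY c k,
    fun k ↦ kanComplex_holim fun d ↦ hY (F.obj d) k, fun i j ↦ ?_⟩
  · rw [Category.id_comp, Category.comp_id]
  · have (n : ℕ) : IsIso ((Spectrum.piSeqMap i j (holimRestrict F Y)).app n) :=
      hF.isIso_loopIter (j + n) (Y ⋙ Spectrum.levelFunctor (i + n)) fun c ↦ hY c (i + n)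
    have := NatIso.isIso_of_isIso_app (Spectrum.piSeqMap i j (holimRestrict F Y))
    exact (isIso_iff_bijective _).1
      (inferInstanceAs (IsIso (colim.map (Spectrum.piSeqMap i j (holimRestrict F Y)))))

end HolimRestrict

/-! ### Contractibility of the complex of chains -/

/-- Two points of `ℕ × ℕ` are equal or comparable for the order `(t, a) < (t', a')` given by
`t < t'` and `a ≤ a'`. The chains of this order are the graphs of weakly increasing maps. -/
def ChainComparable (x y : ℕ × ℕ) : Prop :=
  (x.1 = y.1 ∧ x.2 = y.2) ∨ (x.1 < y.1 ∧ x.2 ≤ y.2) ∨ (y.1 < x.1 ∧ y.2 ≤ x.2)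

/-- The finite nonempty chains in `S × {0, …, q}`. -/
abbrev ChainPoset (S : Set ℕ) (q : ℕ) : Type :=
  { G : Finset (ℕ × ℕ) // G.Nonempty ∧ (∀ x ∈ G, x.1 ∈ S ∧ x.2 ≤ q) ∧
    ∀ x ∈ G, ∀ y ∈ G, ChainComparable x y }

section ChainMaps

variable {S : Set ℕ} {q : ℕ}

variable (S q) in
/-- Two self maps of `S × {0, …, q}` send pairs of comparable points to pairs of comparable
points. -/
structure Contiguous (f g : ℕ × ℕ → ℕ × ℕ) : Prop where
  mem (x : ℕ × ℕ) (hx : x.1 ∈ S) (hx' : x.2 ≤ q) : (f x).1 ∈ S ∧ (f x).2 ≤ q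
  comparable (x y : ℕ × ℕ) (hx : x.1 ∈ S) (hx' : x.2 ≤ q) (hy : y.1 ∈ S) (hy' : y.2 ≤ q)
    (h : ChainComparable x y) : ChainComparable (f x) (g y)

lemma ChainComparable.symm {x y : ℕ × ℕ} (h : ChainComparable x y) : ChainComparable y x := by
  unfold ChainComparable at h ⊢
  omega

lemma Contiguous.mem_of_mem {f g : ℕ × ℕ → ℕ × ℕ} (h : Contiguous S q f g) (G : ChainPoset S q)
    {x : ℕ × ℕ} (hx : x ∈ G.1) : (f x).1 ∈ S ∧ (f x).2 ≤ q :=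
  h.mem x (G.2.2.1 x hx).1 (G.2.2.1 x hx).2

lemma Contiguous.comparable_of_mem {f g : ℕ × ℕ → ℕ × ℕ} (h : Contiguous S q f g)
    (G : ChainPoset S q) {x y : ℕ × ℕ} (hx : x ∈ G.1) (hy : y ∈ G.1) :
    ChainComparable (f x) (g y) :=
  h.comparable x y (G.2.2.1 x hx).1 (G.2.2.1 x hx).2 (G.2.2.1 y hy).1 (G.2.2.1 y hy).2
    (G.2.2.2 x hx y hy)

/-- The self map of the poset of chains induced by a map of points. -/
def chainImage {f : ℕ × ℕ → ℕ × ℕ} (hf : Contiguous S q f f) : ChainPoset S q ⥤ ChainPoset S q :=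
  Monotone.functor (f := fun G ↦ ⟨G.1.image f, G.2.1.image f,
    by
      simp only [Finset.forall_mem_image]
      exact fun x hx ↦ hf.mem_of_mem G hx,
    by
      simp only [Finset.forall_mem_image]
      exact fun x hx y hy ↦ hf.comparable_of_mem G hx hy⟩)
    (fun _ _ h ↦ Finset.image_subset_image h)

/-- The union of the images of a chain under two contiguous maps. -/
def chainUnion {f g : ℕ × ℕ → ℕ × ℕ} (hf : Contiguous S q f f) (hg : Contiguous S q g g)
    (hfg : Contiguous S q f g) : ChainPoset S q ⥤ ChainPoset S q :=
  Monotone.functor (f := fun G ↦ ⟨G.1.image f ∪ G.1.image g, (G.2.1.image f).inl,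
    by
      simp only [Finset.forall_mem_union, Finset.forall_mem_image]
      exact ⟨fun x hx ↦ hf.mem_of_mem G hx, fun x hx ↦ hg.mem_of_mem G hx⟩,
    by
      simp only [Finset.forall_mem_union, Finset.forall_mem_image]
      exact ⟨fun x hx ↦ ⟨fun y hy ↦ hf.comparable_of_mem G hx hy,
          fun y hy ↦ hfg.comparable_of_mem G hx hy⟩,
        fun x hx ↦ ⟨fun y hy ↦ (hfg.comparable_of_mem G hy hx).symm,
          fun y hy ↦ hg.comparable_of_mem G hx hy⟩⟩⟩)
    (fun _ _ h ↦ Finset.union_subset_union (Finset.image_subset_image h)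
      (Finset.image_subset_image h))

lemma nerveHomotopic_chainImage {f g : ℕ × ℕ → ℕ × ℕ} (hf : Contiguous S q f f)
    (hg : Contiguous S q g g) (hfg : Contiguous S q f g) :
    NerveHomotopic (chainImage hf) (chainImage hg) :=
  (nerveHomotopic_of_natTrans (G := chainUnion hf hg hfg)
    { app G := homOfLE (Finset.subset_union_left (s₁ := G.1.image f) (s₂ := G.1.image g)) }).trans
  (nerveHomotopic_of_natTrans (F := chainImage hg) (G := chainUnion hf hg hfg)
    { app G := homOfLE (Finset.subset_union_right (s₁ := G.1.image f) (s₂ := G.1.image g)) }).symm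

lemma nerveHomotopic_chainImage_zero {f : ℕ → ℕ × ℕ → ℕ × ℕ}
    (hf : ∀ k, Contiguous S q (f k) (f k)) (hf' : ∀ k, Contiguous S q (f k) (f (k + 1))) (k : ℕ) :
    NerveHomotopic (chainImage (hf k)) (chainImage (hf 0)) := by
  induction k with
  | zero => exact nerveHomotopic_of_natTrans (𝟙 _)
  | succ k ih => exact (nerveHomotopic_chainImage _ _ (hf' k)).symm.trans ih

/-- The self map of `ℕ × ℕ` that pushes the points `(t, a)` with `a < k` down to `t ≤ a + 1`. It
deforms a chain below the diagonal `t = a + 1`. -/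
def lowerPoints (k : ℕ) (x : ℕ × ℕ) : ℕ × ℕ :=
  (if x.2 < k then min x.1 (x.2 + 1) else x.1, x.2)

/-- The self map of `ℕ × ℕ` that pushes the points `(t, a)` down to `t ≤ a + 1`, and onto
`t = a + 1` if `k ≤ a`. It deforms a chain below the diagonal into the diagonal. -/
def diagonalPoints (k : ℕ) (x : ℕ × ℕ) : ℕ × ℕ :=
  (if x.2 < k then min x.1 (x.2 + 1) else x.2 + 1, x.2)

variable (S q) in
/-- The set `S` is an initial segment of the positive integers that contains `1, …, q + 1`. The
chains in `S × {0, …, q}` then have room for the deformation to the diagonal. -/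
structure IsChainRange : Prop where
  pos {t : ℕ} (ht : t ∈ S) : 1 ≤ t
  down {s t : ℕ} (ht : t ∈ S) (hs : 1 ≤ s) (hst : s ≤ t) : s ∈ S
  succ_mem {a : ℕ} (ha : a ≤ q) : a + 1 ∈ S

lemma contiguous_lowerPoints (h : IsChainRange S q) {k l : ℕ} (hkl : k ≤ l) (hlk : l ≤ k + 1) :
    Contiguous S q (lowerPoints k) (lowerPoints l) where
  mem x hx hx' := by
    have := h.pos hx
    unfold lowerPoints
    refine ⟨?_, hx'⟩
    dsimp only
    split_ifs
    · exact h.down hx (by omega) (by omega)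
    · exact hx
  comparable x y _ _ _ _ hxy := by
    unfold ChainComparable lowerPoints
    unfold ChainComparable at hxy
    dsimp only
    split_ifs <;> omega

lemma contiguous_diagonalPoints (h : IsChainRange S q) {k l : ℕ} (hkl : k ≤ l)
    (hlk : l ≤ k + 1) : Contiguous S q (diagonalPoints k) (diagonalPoints l) where
  mem x hx hx' := by
    have := h.pos hx
    unfold diagonalPoints
    refine ⟨?_, hx'⟩
    dsimp only
    split_ifs
    · exact h.down hx (by omega) (by omega)
    · exact h.succ_mem hx'
  comparable x y _ _ _ _ hxy := by
    unfold ChainComparable diagonalPoints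
    unfold ChainComparable at hxy
    dsimp only
    split_ifs <;> omega

/-- The chain consisting of the point `(1, 0)`. -/
def baseChain (h : IsChainRange S q) : ChainPoset S q :=
  ⟨{(1, 0)}, Finset.singleton_nonempty _, by
    simpa using h.succ_mem (Nat.zero_le q), by simp [ChainComparable]⟩

lemma nerveHomotopic_lowerPoints_id (h : IsChainRange S q) (k : ℕ) :
    NerveHomotopic (𝟭 (ChainPoset S q))
      (chainImage (contiguous_lowerPoints h le_rfl k.le_succ)) :=
  have lowerPoints_zero : NerveHomotopic (𝟭 (ChainPoset S q))
      (chainImage (contiguous_lowerPoints h le_rfl (Nat.le_succ 0))) :=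
    nerveHomotopic_of_natTrans
      { app G := homOfLE fun x hx ↦ Finset.mem_image.2 ⟨x, hx, by simp [lowerPoints]⟩ }
  lowerPoints_zero.trans (nerveHomotopic_chainImage_zero
    (fun l ↦ contiguous_lowerPoints h le_rfl l.le_succ)
    (fun l ↦ contiguous_lowerPoints h l.le_succ le_rfl) k).symm

lemma nerveHomotopic_diagonalPoints_baseChain (h : IsChainRange S q) (k : ℕ) :
    NerveHomotopic (chainImage (contiguous_diagonalPoints h le_rfl k.le_succ))
      ((Functor.const _).obj (baseChain h)) := by
  have hc : Contiguous S q (fun _ ↦ (1, 0)) (fun _ ↦ (1, 0)) :=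
    ⟨fun _ _ _ ↦ ⟨h.succ_mem (Nat.zero_le q), Nat.zero_le q⟩, fun _ _ _ _ _ _ _ ↦ .inl ⟨rfl, rfl⟩⟩
  have hc' : Contiguous S q (diagonalPoints 0) (fun _ ↦ (1, 0)) := by
    refine ⟨(contiguous_diagonalPoints h le_rfl (Nat.le_succ 0)).mem, fun x y _ _ _ _ _ ↦ ?_⟩
    unfold ChainComparable diagonalPoints
    dsimp only
    split_ifs <;> omega
  refine (nerveHomotopic_chainImage_zero
    (fun l ↦ contiguous_diagonalPoints h le_rfl l.le_succ)
    (fun l ↦ contiguous_diagonalPoints h l.le_succ le_rfl) k).trans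
    ((nerveHomotopic_chainImage _ hc hc').trans (nerveHomotopic_of_natTrans
      { app G := homOfLE (Finset.image_subset_iff.2 fun x _ ↦ Finset.mem_singleton_self _) }))

lemma nerveHomotopic_chainPoset (h : IsChainRange S q) :
    NerveHomotopic (𝟭 (ChainPoset S q)) ((Functor.const _).obj (baseChain h)) := by
  have lower_diagonal : NerveHomotopic
      (chainImage (contiguous_lowerPoints h le_rfl (q + 1).le_succ))
      (chainImage (contiguous_diagonalPoints h le_rfl (q + 1).le_succ)) :=
    nerveHomotopic_of_natTrans
      { app G := homOfLE (Finset.image_subset_iff.2 fun x hx ↦ Finset.mem_image.2 ⟨x, hx, by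
          have := (G.2.2.1 x hx).2
          simp [lowerPoints, diagonalPoints, Nat.lt_succ_of_le this]⟩) }
  exact (nerveHomotopic_lowerPoints_id h (q + 1)).trans
    (lower_diagonal.trans (nerveHomotopic_diagonalPoints_baseChain h (q + 1)))

end ChainMaps

/-! ### Left fibers and chains -/

section Fiber

variable {S : Set ℕ} {q : ℕ}

instance {T U : CostructuredArrow (toSimplex S) ⦋q⦌} : Subsingleton (T ⟶ U) :=
  ⟨fun _ _ ↦ CostructuredArrow.hom_ext _ _ (Subsingleton.elim _ _)⟩

/-- The points of the graph of a map `T ⟶ {0, …, q}`. -/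
def graphPoint (x : CostructuredArrow (toSimplex S) ⦋q⦌) (i : Fin ((x.left.1.card - 1) + 1)) :
    ℕ × ℕ :=
  ((x.left.enum i).1, (x.hom.toOrderHom i).1)

lemma graphPoint_map {x y : CostructuredArrow (toSimplex S) ⦋q⦌} (g : x ⟶ y)
    (i : Fin ((x.left.1.card - 1) + 1)) :
    ∃ j, graphPoint y j = graphPoint x i := by
  refine ⟨((toSimplex S).map g.left).toOrderHom i, Prod.ext ?_ ?_⟩
  · exact congrArg Subtype.val (y.left.enum.apply_symm_apply _)
  · exact congrArg (fun u : (toSimplex S).obj x.left ⟶ ⦋q⦌ ↦ (u.toOrderHom i).1)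
      (CostructuredArrow.w g)

/-- The graph of a map `T ⟶ {0, …, q}`, as a functor to the poset of chains. -/
def graphFunctor (S : Set ℕ) (q : ℕ) :
    CostructuredArrow (toSimplex S) ⦋q⦌ ⥤ ChainPoset S q where
  obj x := ⟨Finset.univ.image (graphPoint x), Finset.univ_nonempty.image _, by
      simp only [Finset.forall_mem_image]
      exact fun i _ ↦ ⟨x.left.2.2 (x.left.enum i).2, Nat.le_of_lt_succ (x.hom.toOrderHom i).2⟩, by
      simp only [Finset.forall_mem_image]
      intro i _ j _
      obtain hij | rfl | hij := lt_trichotomy i j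
      · exact .inr (.inl ⟨x.left.enum.strictMono hij, x.hom.toOrderHom.monotone hij.le⟩)
      · exact .inl ⟨rfl, rfl⟩
      · exact .inr (.inr ⟨x.left.enum.strictMono hij, x.hom.toOrderHom.monotone hij.le⟩)⟩
  map {x y} g := homOfLE (Finset.image_subset_iff.2 fun i _ ↦ by
    obtain ⟨j, hj⟩ := graphPoint_map g i
    exact Finset.mem_image.2 ⟨j, Finset.mem_univ j, hj⟩)

/-- The largest second coordinate of the points of a chain with first coordinate at most `t`. -/
def chainValue (G : Finset (ℕ × ℕ)) (t : ℕ) : ℕ := (G.filter (·.1 ≤ t)).sup Prod.snd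

lemma chainValue_mono (G : Finset (ℕ × ℕ)) : Monotone (chainValue G) := by
  intro s t hst
  refine Finset.sup_mono fun x hx ↦ ?_
  rw [Finset.mem_filter] at hx ⊢
  exact ⟨hx.1, hx.2.trans hst⟩

lemma chainValue_eq (G : ChainPoset S q) {x : ℕ × ℕ} (hx : x ∈ G.1) :
    chainValue G.1 x.1 = x.2 := by
  refine le_antisymm (Finset.sup_le fun y hy ↦ ?_) (Finset.le_sup (f := Prod.snd)
    (Finset.mem_filter.2 ⟨hx, le_rfl⟩))
  obtain ⟨hy, hyx⟩ := Finset.mem_filter.1 hy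
  have h := G.2.2.2 x hx y hy
  unfold ChainComparable at h
  omega

/-- The set of first coordinates of a chain. -/
def chainSupport (G : ChainPoset S q) : FinSub S :=
  ⟨G.1.image Prod.fst, G.2.1.image _, fun t ht ↦ by
    obtain ⟨x, hx, rfl⟩ := Finset.mem_image.1 ht
    exact (G.2.2.1 x hx).1⟩

/-- The map `T ⟶ {0, …, q}` whose graph is a given chain. -/
def chainHom (G : ChainPoset S q) : (toSimplex S).obj (chainSupport G) ⟶ ⦋q⦌ :=
  SimplexCategory.mkHom
    { toFun i := ⟨chainValue G.1 ((chainSupport G).enum i).1, Nat.lt_succ_of_le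
        (Finset.sup_le fun x hx ↦ (G.2.2.1 x (Finset.mem_filter.1 hx).1).2)⟩
      monotone' _ _ hij := chainValue_mono G.1 ((chainSupport G).enum.monotone hij) }

lemma chainHom_comp {G : ChainPoset S q} {T : FinSub S} (g : chainSupport G ⟶ T)
    (u : (toSimplex S).obj T ⟶ ⦋q⦌)
    (h : ∀ x ∈ G.1, ∀ j, (T.enum j).1 = x.1 → (u.toOrderHom j).1 = x.2) :
    (toSimplex S).map g ≫ u = chainHom G := by
  ext i : 3
  apply Fin.ext
  obtain ⟨x, hx, hxi⟩ := Finset.mem_image.1 ((chainSupport G).enum i).2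
  change (u.toOrderHom (((toSimplex S).map g).toOrderHom i)).1 =
    chainValue G.1 ((chainSupport G).enum i).1
  rw [← hxi, chainValue_eq G hx]
  exact h x hx _ ((congrArg Subtype.val (T.enum.apply_symm_apply _)).trans hxi.symm)

lemma chainHom_apply (G : ChainPoset S q) (x : ℕ × ℕ) (hx : x ∈ G.1)
    (j : Fin (((chainSupport G).1.card - 1) + 1)) (hj : ((chainSupport G).enum j).1 = x.1) :
    ((chainHom G).toOrderHom j).1 = x.2 := by
  change chainValue G.1 ((chainSupport G).enum j).1 = x.2
  rw [hj, chainValue_eq G hx]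

/-- A chain, viewed as the graph of a map `T ⟶ {0, …, q}`. -/
def chainArrow (S : Set ℕ) (q : ℕ) :
    ChainPoset S q ⥤ CostructuredArrow (toSimplex S) ⦋q⦌ where
  obj G := CostructuredArrow.mk (chainHom G)
  map {G G'} g := CostructuredArrow.homMk
    (homOfLE (Finset.image_subset_image (leOfHom g)) : chainSupport G ⟶ chainSupport G')
    (chainHom_comp _ _ fun x hx ↦ chainHom_apply G' x (leOfHom g hx))

/-- The support of the graph of a map `T ⟶ {0, …, q}` is contained in `T`; with
`isContractible_nerve_of_retract` this makes the left fiber a homotopy retract of the chains. -/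
def graphFunctorChainArrow (S : Set ℕ) (q : ℕ) : graphFunctor S q ⋙ chainArrow S q ⟶ 𝟭 _ where
  app x := CostructuredArrow.homMk
    (homOfLE (by
      intro t ht
      obtain ⟨z, hz, rfl⟩ := Finset.mem_image.1 ht
      obtain ⟨i, -, rfl⟩ := Finset.mem_image.1 hz
      exact (x.left.enum i).2) : chainSupport ((graphFunctor S q).obj x) ⟶ x.left)
    (chainHom_comp _ _ fun z hz j hj ↦ by
      obtain ⟨i, -, rfl⟩ := Finset.mem_image.1 hz
      obtain rfl : j = i := x.left.enum.injective (Subtype.ext hj)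
      rfl)
  naturality _ _ _ := Subsingleton.elim _ _

lemma IsChainRange.isContractible_nerve_toSimplex (h : IsChainRange S q) :
    IsContractible (nerve (CostructuredArrow (toSimplex S) ⦋q⦌)) :=
  isContractible_nerve_of_retract (graphFunctor S q) (chainArrow S q)
    (graphFunctorChainArrow S q) (nerveHomotopic_chainPoset h)

end Fiber

lemma isLeftCofinal_toDelta : IsLeftCofinal toDelta := fun _ ↦
  IsChainRange.isContractible_nerve_toSimplex
    { pos ht := ht
      down _ hs _ := hs
      succ_mem _ := Nat.succ_pos _ }

lemma isLeftCofinal_toDeltaLT (n : ℕ) : IsLeftCofinal (toDeltaLT n) := fun c ↦ by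
  let e := CostructuredArrow.post (toDeltaLT n) (ObjectProperty.ι _) c
  have h : IsChainRange (Set.Icc 1 n) c.obj.len :=
    { pos ht := ht.1
      down ht hs hst := ⟨hs, hst.trans ht.2⟩
      succ_mem ha := ⟨Nat.succ_pos _, lt_of_le_of_lt ha c.property⟩ }
  exact isContractible_nerve_of_retract (e ⋙ graphFunctor (Set.Icc 1 n) c.obj.len)
    (chainArrow _ _ ⋙ e.inv)
    (Functor.whiskerRight (Functor.whiskerLeft e (graphFunctorChainArrow _ _)) e.inv ≫
      e.asEquivalence.unitInv)
    (nerveHomotopic_chainPoset h)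

end

end CosimplicialDescent

theorem mainTheorem7_general :
    (IsLeftCofinal toDelta ∧ ∀ n : ℕ, IsLeftCofinal (toDeltaLT n)) ∧
    (∀ Y : SimplexCategory ⥤ Spectrum, (∀ c, (Y.obj c).IsLevelKan) →
      Spectrum.IsStableEquiv (holimRestrict toDelta Y)) ∧
    (∀ (n : ℕ) (Y : DeltaLT n ⥤ Spectrum), (∀ c, (Y.obj c).IsLevelKan) →
      Spectrum.IsStableEquiv (holimRestrict (toDeltaLT n) Y)) :=
  ⟨⟨isLeftCofinal_toDelta, isLeftCofinal_toDeltaLT⟩,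
    isLeftCofinal_toDelta.isStableEquiv_holimRestrict,
    fun n ↦ (isLeftCofinal_toDeltaLT n).isStableEquiv_holimRestrict⟩

theorem mainTheorem7 :
    (IsLeftCofinal toDelta ∧ ∀ n : ℕ, 1 ≤ n → IsLeftCofinal (toDeltaLT n)) ∧
    (∀ (Y Y' : SimplexCategory ⥤ Spectrum) (r : Y ⟶ Y'), IsFibrantReplacement r →
      Spectrum.IsStableEquiv (holimRestrict toDelta Y')) ∧
    (∀ n : ℕ, 1 ≤ n → ∀ (Y Y' : DeltaLT n ⥤ Spectrum) (r : Y ⟶ Y'), IsFibrantReplacement r →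
      Spectrum.IsStableEquiv (holimRestrict (toDeltaLT n) Y')) :=
  let ⟨⟨cofinal, cofinalLT⟩, equiv, equivLT⟩ := mainTheorem7_general
  ⟨⟨cofinal, fun n _ ↦ cofinalLT n⟩, fun _ Y' _ hr ↦ equiv Y' fun c ↦ (hr c).1.1,
    fun n _ _ Y' _ hr ↦ equivLT n Y' fun c ↦ (hr c).1.1⟩
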